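/- Let $\mu>0$, let $\alpha\neq\beta$ be real, and put $d=\frac1{\beta-\alpha}$, $a=\frac{(1+\alpha^2)^2}{4(\beta-\alpha)}$, $c=-\frac{3(1+\alpha\beta)(1+\alpha^2)}{2(\beta-\alpha)^2}$; let $\lambda$ be either of the two (real, nonzero) roots of $\lambda^2+c\lambda-2ad=0$. For $\omega\in\mathbb R$ put $b=\frac{1+\alpha^2}{2}\Big(\frac{2(\alpha\omega+\mu)}{\beta-\alpha}-\frac{3(1+\alpha\beta)(\omega-\mu\alpha)}{(\beta-\alpha)^2}\Big)$, $e=\frac{\omega-\mu\alpha}{\beta-\alpha}$, $\tilde e=\lambda b/a$. Consider the 4-D system $$\dot{\tilde M}=\tilde N P,\qquad \dot{\tilde N}=\tfrac{\lambda}{a}\tilde M+kP,\qquad \dot P=Q,\qquad \dot Q=\tfrac1\lambda(\tilde M-dP^2-\tilde eP),$$ with $e=\tilde e+\frac a\lambda k$, and the consistency condition $(1+\alpha^2)M=(\frac a\lambda\tilde N-\lambda Q)^2$, where $$M=\tfrac{d(1+\alpha^2)}{2\lambda}(dP+e)(\tilde M-dP^2-\tilde eP)-\tfrac{d^2(1+\alpha^2)}4Q^2+(\alpha\omega+\mu)(dP+e)^2-(1+\alpha\beta)(dP+e)^3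 .$$ Let $a_2\neq0$ and $\sigma\in\{1,-1\}$. Then there are $\varepsilon_0>0$, $C\in\mathbb R$, continuous functions $\omega,k_1,k_2,\gamma,\Omega,q$ of $\varepsilon\in(-\varepsilon_0,\varepsilon_0)$ and $X=(x,y,z,w)(\varepsilon,\tau)$, jointly continuous in $\varepsilon\in(-\varepsilon_0,\varepsilon_0)$, $\tau\in\mathbb R$, such that at $\varepsilon=0$ $$\omega=\mu\alpha,\quad k_2=-\tfrac{3\lambda}{a}da_2,\quad \gamma=\tfrac ca a_2,\quad \Omega=2\sqrt\mu,\quad q=\sqrt\mu,$$ $$X(0,\tau)=\big(4\mu\lambda a_2,\ -\tfrac{\lambda^2}{a}\Omega a_4\sin\Omega\tau,\ a_2+a_4\cos\Omega\tau,\ -\Omega a_4\sin\Omega\tau\big)\quad\text{with } a_4=2\sigma a_2,\ \Omega=2\sqrt\mu,$$ and such that for every $\varepsilon\in(-\varepsilon_0,\varepsilon_0)$, with all constants taken at $\omega=\omega(\varepsilon)$: 1. $\tilde e/\lambda>0$; $k_1=-\lambda\tilde e/a$; the matrix of the linear part of the 4-D system at the origin with $k=k_1$ has a two-dimensional kernel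 (its eigenvalue $0$ has two independent eigenvectors); $e=\tilde e+\frac a\lambda(k_1+\varepsilon k_2)$; $\Omega>0$ and $\Omega^2=\tilde e/\lambda+\varepsilon\gamma$; $q>0$, $\omega=\mu\beta+(\alpha-\beta)q^2$ and $e=\mu-q^2$, i.e. $\pm q$ are the wavenumbers of the plane waves of frequency $\omega$, and they tend to $\pm\sqrt\mu$ as $\varepsilon\to0$. 2. $X(\varepsilon,\cdot)$ solves the 4-D system with $k=k_1+\varepsilon k_2$ rescaled by $(\tilde M,\tilde N,P,Q)=\varepsilon(x,y,z,w)$, and $(\tilde M,\tilde N,P,Q)=\varepsilon X(\varepsilon,\cdot)$ solves the 4-D system itself and satisfies the consistency condition at every $\tau$. It is symmetric ($x,z$ even, $y,w$ odd in $\tau$), periodic of period $2\pi/\Omega$, bounded by $\|X(\varepsilon,\tau)\|_\infty\le C$ for all $\tau$, and $z(\varepsilon,\cdot)$ is not constant. 3. If $\varepsilon d a_2<0$, there are $C^2$ functions $R,\varphi:\mathbb R\to\mathbb R$ such that, with $G=\varphi_xR^2$, $$(1+\alpha^2)G_x=(\beta-\alpha)R^4-(\omega-\mu\alpha)R^2,\qquad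 (1+\alpha^2)G^2=(1+\alpha^2)R^3R_{xx}+(\alpha\omega+\mu)R^4-(1+\alpha\beta)R^6,$$ $R^2=e+dP$, $G=(\frac a\lambda\tilde N-\lambda Q)/(1+\alpha^2)$, $R(-x)=-\sigma R(x)$, $\varphi(-x)=\varphi(x)$, $R(x+\frac{2\pi}\Omega)=-R(x)$, $\varphi(x+\frac{2\pi}\Omega)=\varphi(x)$, $R^2\le C|\varepsilon|$; and $A(x,t)=R(x)e^{i\varphi(x)-i\omega t}$ is a classical solution of $A_t=\mu A+(1+i\alpha)A_{xx}-(1+i\beta)|A|^2A$. These are stationary modulated-amplitude waves bifurcating from $A=0$. -/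

import Mathlib

noncomputable section

namespace CGL

/-! Constants of the reduction of the stationary equation. -/

/-- `d = 1 / (β - α)`. -/
def dC (α β : ℝ) : ℝ := 1 / (β - α)

/-- `a = (1 + α²)² / (4 (β - α))`. -/
def aC (α β : ℝ) : ℝ := (1 + α ^ 2) ^ 2 / (4 * (β - α))

def bC (μ α β ω : ℝ) : ℝ :=
  (1 + α ^ 2) / 2 *
    (2 * (α * ω + μ) / (β - α) - 3 * (1 + α * β) * (ω - μ * α) / (β - α) ^ 2)

def cC (α β : ℝ) : ℝ := -(3 * (1 + α * β) * (1 + α ^ 2) / (2 * (β - α) ^ 2))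

/-- `e = (ω - μ α) / (β - α)`, the squared amplitude of the plane wave of frequency `ω`. -/
def eC (μ α β ω : ℝ) : ℝ := (ω - μ * α) / (β - α)

/-- `ẽ`, determined by `a / lam = b / ẽ`. -/
def eTilde (μ α β lam ω : ℝ) : ℝ := lam * bC μ α β ω / aC α β

/-- The admissible values of `lam` are the two roots of `lam² + c lam - 2 a d = 0`. -/
def IsLambda (α β lam : ℝ) : Prop :=
  lam ^ 2 + cC α β * lam - 2 * aC α β * dC α β = 0

/-! The 4-D system for `(M̃, Ñ, P, Q)`, in this order. -/

/-- The vector field of the 4-D system. -/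
def field4 (μ α β lam ω k : ℝ) (X : Fin 4 → ℝ) : Fin 4 → ℝ :=
  ![X 1 * X 2,
    lam / aC α β * X 0 + k * X 2,
    X 3,
    1 / lam * (X 0 - dC α β * X 2 ^ 2 - eTilde μ α β lam ω * X 2)]

/-- The matrix of the linear part at the origin, for `k = k₁` at lowest order. -/
def linMatrix (μ α β lam ω k₁ : ℝ) : Matrix (Fin 4) (Fin 4) ℝ :=
  !![0, 0, 0, 0;
     lam / aC α β, 0, k₁, 0;
     0, 0, 0, 1;
     1 / lam, 0, -eTilde μ α β lam ω / lam, 0]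

/-- The quadratic part of the system rescaled by `ε`, for `k = k₁ + ε k₂`. -/
def quadPart (α β lam k₂ : ℝ) (X : Fin 4 → ℝ) : Fin 4 → ℝ :=
  ![X 1 * X 2, k₂ * X 2, 0, -(dC α β / lam) * X 2 ^ 2]

/-- The quantity `M` expressed in the variables `(M̃, Ñ, P, Q)`. -/
def bigM (μ α β lam ω : ℝ) (X : Fin 4 → ℝ) : ℝ :=
  dC α β * (1 + α ^ 2) / (2 * lam) * (dC α β * X 2 + eC μ α β ω)
      * (X 0 - dC α β * X 2 ^ 2 - eTilde μ α β lam ω * X 2)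
    - dC α β ^ 2 * (1 + α ^ 2) / 4 * X 3 ^ 2
    + (α * ω + μ) * (dC α β * X 2 + eC μ α β ω) ^ 2
    - (1 + α * β) * (dC α β * X 2 + eC μ α β ω) ^ 3

/-- The consistency condition at a point of the phase space. -/
def Consistent (μ α β lam ω : ℝ) (X : Fin 4 → ℝ) : Prop :=
  (1 + α ^ 2) * bigM μ α β lam ω X = (aC α β / lam * X 1 - lam * X 3) ^ 2

/-- Reversibility of an orbit: `M̃`, `P` are even and `Ñ`, `Q` are odd. -/
def IsSymmetricOrbit (X : ℝ → Fin 4 → ℝ) : Prop :=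
  ∀ τ, X (-τ) = ![X τ 0, -X τ 1, X τ 2, -X τ 3]

/-- The lowest-order orbit, of angular frequency `2 √μ`. The sign `σ = ± 1` is that of the
coefficient `a₄ = ± 2 a₂` of the oscillating part. -/
def zeroOrder (μ α β lam a₂ σ τ : ℝ) : Fin 4 → ℝ :=
  ![4 * μ * lam * a₂,
    -(lam ^ 2 / aC α β * (2 * √μ) * (2 * σ * a₂) * Real.sin (2 * √μ * τ)),
    a₂ + 2 * σ * a₂ * Real.cos (2 * √μ * τ),
    -(2 * √μ * (2 * σ * a₂) * Real.sin (2 * √μ * τ))]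

/-! The Ginzburg-Landau equation and its stationary form. -/

/-- `A` is a classical solution of
`A_t = μ A + (1 + i α) A_xx - (1 + i β) |A|² A` on the whole line, for all times. -/
def SolvesCGL (μ α β : ℝ) (A : ℝ → ℝ → ℂ) : Prop :=
  (∀ t, ContDiff ℝ 2 (fun x => A x t)) ∧ (∀ x, ContDiff ℝ 1 (fun t => A x t)) ∧
  ∀ x t, deriv (fun s => A x s) t =
    μ * A x t + (1 + Complex.I * α) * iteratedDeriv 2 (fun y => A y t) x
      - (1 + Complex.I * β) * (‖A x t‖ : ℂ) ^ 2 * A x t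

/-- The "angular momentum" `G = φ_x R²`. -/
def angMom (R φ : ℝ → ℝ) (x : ℝ) : ℝ := deriv φ x * R x ^ 2

/-- The two real equations satisfied by the profile `R` and the phase `φ` of a stationary
solution `R(x) exp (i φ(x) - i ω t)`. -/
def SolvesStationary (μ α β ω : ℝ) (R φ : ℝ → ℝ) : Prop :=
  ContDiff ℝ 2 R ∧ ContDiff ℝ 2 φ ∧
  (∀ x, (1 + α ^ 2) * deriv (angMom R φ) x =
    (β - α) * R x ^ 4 - (ω - μ * α) * R x ^ 2) ∧
  (∀ x, (1 + α ^ 2) * angMom R φ x ^ 2 =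
    (1 + α ^ 2) * R x ^ 3 * iteratedDeriv 2 R x + (α * ω + μ) * R x ^ 4
      - (1 + α * β) * R x ^ 6)

end CGL

end

/-!
Dividing the stationary equation by `1 + iα` turns it into `V'' = -pV + q|V|²V` with complex
constants `p`, `q`. Writing `V = √(εD) B`, the rescaled point of the 4-D system is a quadratic
function of `(B, B')` in which only `ε`, and no square root of it, occurs. Hence the orbits exist
for both signs of `ε` and inherit symmetry, periodicity and consistency from `B`.

The profile `B` is found by Lyapunov-Schmidt reduction about the cosine. Among the even
`π`-antiperiodic functions only the cosine is resonant. Its component is absorbed into an unknown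
linear coefficient `1 + tνr(t)`, and a contraction yields a family continuous in `t`. The complex
equation `(Ω/2)² (1 + tνr) = (μ + iω) / (1 + iα)` then determines the two real unknowns `Ω` and `ω`.

The quotient of the profile by the cosine stays close to `1`, so that it has a smooth logarithm,
which gives the polar form with a signed amplitude `R`. A shift by a quarter period changes the
parity of `R` and corresponds to the other sign of `σ`.
-/

noncomputable section

namespace CGL

open BoundedContinuousFunction ComplexConjugate

section FixedPoint

variable {E : Type*} [NormedAddCommGroup E] {𝕜 : Type*} [NormedField 𝕜] [NormedSpace 𝕜 E]
  {F : E → E} {M L t₀ : ℝ}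

theorem exists_fixedPoint_smul [CompleteSpace E]
    (hM : ∀ v, ‖v‖ ≤ 1 → ‖F v‖ ≤ M)
    (hL : ∀ v w, ‖v‖ ≤ 1 → ‖w‖ ≤ 1 → ‖F v - F w‖ ≤ L * ‖v - w‖)
    (htM : t₀ * M ≤ 1) (htL : t₀ * L ≤ 1 / 2) {s : 𝕜} (hs : ‖s‖ ≤ t₀) :
    ∃ v : E, ‖v‖ ≤ 1 ∧ v = s • F v := by
  have ht₀ : 0 ≤ t₀ := (norm_nonneg s).trans hs
  have hmaps : Set.MapsTo (fun v => s • F v) (Metric.closedBall (0 : E) 1)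
      (Metric.closedBall (0 : E) 1) := by
    intro v hv
    rw [mem_closedBall_zero_iff] at hv ⊢
    rw [norm_smul]
    calc ‖s‖ * ‖F v‖ ≤ t₀ * M := by gcongr; exact hM v hv
      _ ≤ 1 := htM
  have hcontr : ContractingWith (1 / 2 : NNReal) (hmaps.restrict _ _ _) := by
    refine ⟨by rw [← NNReal.coe_lt_coe]; norm_num, LipschitzWith.of_dist_le_mul ?_⟩
    rintro ⟨v, hv⟩ ⟨w, hw⟩
    rw [mem_closedBall_zero_iff] at hv hw
    change dist (s • F v) (s • F w) ≤ _ * dist v w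
    rw [dist_eq_norm, dist_eq_norm, ← smul_sub, norm_smul]
    calc ‖s‖ * ‖F v - F w‖ ≤ t₀ * (L * ‖v - w‖) := by gcongr; exact hL v w hv hw
      _ = t₀ * L * ‖v - w‖ := by ring
      _ ≤ 1 / 2 * ‖v - w‖ := by gcongr
      _ = _ := by simp
  obtain ⟨v, hv, hfix, -⟩ := ContractingWith.exists_fixedPoint'
    Metric.isClosed_closedBall.isComplete hmaps hcontr (x := 0) (by simp) (edist_ne_top _ _)
  exact ⟨v, mem_closedBall_zero_iff.1 hv, hfix.symm⟩

theorem norm_fixedPoint_smul_sub_le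
    (hM : ∀ v, ‖v‖ ≤ 1 → ‖F v‖ ≤ M)
    (hL : ∀ v w, ‖v‖ ≤ 1 → ‖w‖ ≤ 1 → ‖F v - F w‖ ≤ L * ‖v - w‖)
    (htL : t₀ * L ≤ 1 / 2) {s t : 𝕜} (hs : ‖s‖ ≤ t₀) {v w : E} (hv : ‖v‖ ≤ 1)
    (hw : ‖w‖ ≤ 1) (hvF : v = s • F v) (hwF : w = t • F w) :
    ‖v - w‖ ≤ 2 * M * ‖s - t‖ := by
  have ht₀ : 0 ≤ t₀ := (norm_nonneg s).trans hs
  have hsplit : v - w = s • (F v - F w) + (s - t) • F w := by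
    conv_lhs => rw [hvF, hwF]
    rw [smul_sub, sub_smul]
    abel
  have hself : ‖v - w‖ ≤ 1 / 2 * ‖v - w‖ + ‖s - t‖ * M := by
    calc ‖v - w‖ ≤ ‖s‖ * ‖F v - F w‖ + ‖s - t‖ * ‖F w‖ := by
          rw [← norm_smul, ← norm_smul]
          conv_lhs => rw [hsplit]
          exact norm_add_le _ _
      _ ≤ t₀ * (L * ‖v - w‖) + ‖s - t‖ * M := by
          gcongr
          exacts [hL v w hv hw, hM w hw]
      _ = t₀ * L * ‖v - w‖ + ‖s - t‖ * M := by ring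
      _ ≤ _ := by gcongr
  linarith

end FixedPoint

theorem exists_continuous_fixedPoint_smul {E : Type*} [NormedAddCommGroup E] [NormedSpace ℝ E]
    [CompleteSpace E] {F : E → E} {M L t₀ : ℝ} (ht₀ : 0 ≤ t₀)
    (hM : ∀ v, ‖v‖ ≤ 1 → ‖F v‖ ≤ M)
    (hL : ∀ v w, ‖v‖ ≤ 1 → ‖w‖ ≤ 1 → ‖F v - F w‖ ≤ L * ‖v - w‖)
    (htM : t₀ * M ≤ 1) (htL : t₀ * L ≤ 1 / 2) :
    ∃ v : ℝ → E, Continuous v ∧ ∀ t, |t| ≤ t₀ → ‖v t‖ ≤ 1 ∧ v t = t • F (v t) := by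
  let clamp : ℝ → ℝ := fun t => max (-t₀) (min t t₀)
  have hclamp : ∀ t, ‖clamp t‖ ≤ t₀ := fun t =>
    abs_le.2 ⟨le_max_left _ _, max_le (by linarith) (min_le_right _ _)⟩
  choose v hv hvF using fun t => exists_fixedPoint_smul hM hL htM htL (hclamp t)
  refine ⟨v, ?_, fun t ht => ⟨hv t, ?_⟩⟩
  · refine continuous_iff_continuousAt.2 fun t => tendsto_iff_norm_sub_tendsto_zero.2 ?_
    have hlip s : ‖v s - v t‖ ≤ 2 * M * ‖clamp s - clamp t‖ :=
      norm_fixedPoint_smul_sub_le hM hL htL (hclamp s) (hv s) (hv t) (hvF s) (hvF t)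
    refine squeeze_zero (fun _ => norm_nonneg _) hlip ?_
    have hcont : Continuous fun s => 2 * M * ‖clamp s - clamp t‖ := by fun_prop
    simpa using hcont.tendsto t
  · have hct : clamp t = t := by
      obtain ⟨hneg, hpos⟩ := abs_le.1 ht
      simp only [clamp, min_eq_left hpos, max_eq_right hneg]
    simpa only [hct] using hvF t

section EvenAntiperiodic

variable {E : Type*} [NormedAddCommGroup E] {f g : ℝ → E}

/-- Continuous even `π`-antiperiodic functions: the cosine series with odd modes only. -/
structure EvenAntiperiodic (f : ℝ → E) : Prop where
  continuous : Continuous f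
  even : Function.Even f
  antiperiodic : Function.Antiperiodic f Real.pi

namespace EvenAntiperiodic

theorem add (hf : EvenAntiperiodic f) (hg : EvenAntiperiodic g) :
    EvenAntiperiodic fun s => f s + g s where
  continuous := hf.continuous.add hg.continuous
  even s := by simp only [hf.even s, hg.even s]
  antiperiodic s := by simp only [hf.antiperiodic s, hg.antiperiodic s, neg_add]

theorem sub (hf : EvenAntiperiodic f) (hg : EvenAntiperiodic g) :
    EvenAntiperiodic fun s => f s - g s where
  continuous := hf.continuous.sub hg.continuous
  even s := by simp only [hf.even s, hg.even s]
  antiperiodic s := by simp only [hf.antiperiodic s, hg.antiperiodic s]; abel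

theorem comp_odd {F : Type*} [NormedAddCommGroup F] {L : E → F}
    (hf : EvenAntiperiodic f) (hL : Continuous L) (hodd : Function.Odd L) :
    EvenAntiperiodic fun s => L (f s) where
  continuous := hL.comp hf.continuous
  even s := by simp only [hf.even s]
  antiperiodic s := by simp only [hf.antiperiodic s, hodd (f s)]

theorem const_smul {𝕜 : Type*} [NormedField 𝕜] [NormedSpace 𝕜 E] (c : 𝕜)
    (hf : EvenAntiperiodic f) : EvenAntiperiodic fun s => c • f s :=
  hf.comp_odd (continuous_const_smul c) fun _ => smul_neg c _

theorem exists_norm_le (hf : EvenAntiperiodic f) : ∃ C, ∀ s, ‖f s‖ ≤ C := by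
  obtain ⟨C, hC⟩ := isBounded_iff_forall_norm_le.1
    (hf.antiperiodic.periodic_two_mul.isBounded_of_continuous (by positivity) hf.continuous)
  exact ⟨C, fun s => hC _ ⟨s, rfl⟩⟩

end EvenAntiperiodic

end EvenAntiperiodic

section Resonance

variable {E : Type*} [NormedAddCommGroup E] [NormedSpace ℝ E] {f g : ℝ → E} {h : ℝ → ℝ} {C : ℝ}

theorem norm_smul_le_of_abs_le_one {c : ℝ} (hc : |c| ≤ 1) (x : E) : ‖c • x‖ ≤ ‖x‖ := by
  rw [norm_smul]
  exact mul_le_of_le_one_left (norm_nonneg x) hc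

/-- The primitive of `h • f` that vanishes at the origin; the weight `h` will be `cos` or `sin`. -/
def weightedPrim (h : ℝ → ℝ) (f : ℝ → E) (θ : ℝ) : E := ∫ s in (0 : ℝ)..θ, h s • f s

theorem weightedPrim_sub (hh : Continuous h) (hf : Continuous f) (hg : Continuous g) (θ : ℝ) :
    weightedPrim h (fun s => f s - g s) θ = weightedPrim h f θ - weightedPrim h g θ := by
  simp only [weightedPrim, smul_sub]
  exact intervalIntegral.integral_sub ((hh.smul hf).intervalIntegrable _ _)
    ((hh.smul hg).intervalIntegrable _ _)

theorem weightedPrim_const_smul {𝕜 : Type*} [NormedField 𝕜] [NormedSpace 𝕜 E] [SMulCommClass ℝ 𝕜 E]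
    (h : ℝ → ℝ) (c : 𝕜) (f : ℝ → E) (θ : ℝ) :
    weightedPrim h (fun s => c • f s) θ = c • weightedPrim h f θ := by
  simp only [weightedPrim, smul_comm _ c, intervalIntegral.integral_smul]

theorem hasDerivAt_weightedPrim [CompleteSpace E] (hh : Continuous h) (hf : Continuous f)
    (θ : ℝ) : HasDerivAt (weightedPrim h f) (h θ • f θ) θ :=
  (hh.smul hf).integral_hasStrictDerivAt 0 θ |>.hasDerivAt

theorem weightedPrim_neg (h : ℝ → ℝ) (f : ℝ → E) (θ : ℝ) :
    weightedPrim h f (-θ) = -weightedPrim (fun s => h (-s)) (fun s => f (-s)) θ := by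
  simp only [weightedPrim]
  rw [intervalIntegral.integral_comp_neg fun s => h s • f s, neg_zero,
    intervalIntegral.integral_symm]

theorem norm_weightedPrim_le_mul_abs (hh : ∀ s, |h s| ≤ 1) (hC : ∀ s, ‖f s‖ ≤ C) (θ : ℝ) :
    ‖weightedPrim h f θ‖ ≤ C * |θ| := by
  have hbound s : ‖h s • f s‖ ≤ C := (norm_smul_le_of_abs_le_one (hh s) _).trans (hC s)
  simpa [weightedPrim] using intervalIntegral.norm_integral_le_of_norm_le_const (a := 0) (b := θ)
    fun s _ => hbound s

theorem continuous_weightedPrim_uncurry {X : Type*} [TopologicalSpace X] {f : X → ℝ → E}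
    (hh : Continuous h) (hf : Continuous (Function.uncurry f)) :
    Continuous fun p : X × ℝ => weightedPrim h (f p.1) p.2 :=
  intervalIntegral.continuous_parametric_intervalIntegral_of_continuous
    (f := fun (p : X × ℝ) s => h s • f p.1 s)
    ((hh.comp continuous_snd).smul
      (hf.comp (by fun_prop : Continuous fun q : (X × ℝ) × ℝ => (q.1.1, q.2)))) continuous_snd

/-- The coefficient of `cos` in the cosine expansion of `f` on `[0, π]`, normalised so that
`cosCoeff (cos • e) = e`. -/
def cosCoeff (f : ℝ → E) : E := (2 / Real.pi) • weightedPrim Real.cos f Real.pi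

theorem cosCoeff_sub (hf : Continuous f) (hg : Continuous g) :
    cosCoeff (fun s => f s - g s) = cosCoeff f - cosCoeff g := by
  rw [cosCoeff, weightedPrim_sub Real.continuous_cos hf hg, smul_sub, cosCoeff, cosCoeff]

theorem cosCoeff_const_smul {𝕜 : Type*} [NormedField 𝕜] [NormedSpace 𝕜 E] [SMulCommClass ℝ 𝕜 E]
    (c : 𝕜) (f : ℝ → E) :
    cosCoeff (fun s => c • f s) = c • cosCoeff f := by
  rw [cosCoeff, weightedPrim_const_smul, smul_comm, cosCoeff]

theorem cosCoeff_neg (f : ℝ → E) : cosCoeff (fun s => -f s) = -cosCoeff f := by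
  simpa using cosCoeff_const_smul (-1 : ℝ) f

theorem cosCoeff_add (hf : Continuous f) (hg : Continuous g) :
    cosCoeff (fun s => f s + g s) = cosCoeff f + cosCoeff g := by
  simpa [cosCoeff_neg] using cosCoeff_sub hf hg.fun_neg

theorem cosCoeff_cos_smul [CompleteSpace E] (e : E) : cosCoeff (fun s => Real.cos s • e) = e := by
  simp only [cosCoeff, weightedPrim, smul_smul, ← sq]
  rw [intervalIntegral.integral_smul_const, integral_cos_sq, smul_smul]
  simp

theorem norm_cosCoeff_le (hC : ∀ s, ‖f s‖ ≤ C) : ‖cosCoeff f‖ ≤ 2 * C := by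
  have h := norm_weightedPrim_le_mul_abs Real.abs_cos_le_one hC Real.pi
  rw [abs_of_pos Real.pi_pos] at h
  rw [cosCoeff, norm_smul, Real.norm_of_nonneg (by positivity)]
  calc 2 / Real.pi * ‖weightedPrim Real.cos f Real.pi‖ ≤ 2 / Real.pi * (C * Real.pi) := by gcongr
    _ = 2 * C := by field_simp

theorem continuous_cosCoeff {X : Type*} [TopologicalSpace X] {f : X → ℝ → E}
    (hf : Continuous (Function.uncurry f)) : Continuous fun x => cosCoeff (f x) :=
  ((continuous_weightedPrim_uncurry Real.continuous_cos hf).comp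
    (continuous_id.prodMk continuous_const)).const_smul _

namespace EvenAntiperiodic

theorem cos_smul (e : E) : EvenAntiperiodic fun s => Real.cos s • e where
  continuous := by fun_prop
  even s := by simp only [Real.cos_neg]
  antiperiodic s := by simp only [Real.cos_add_pi, neg_smul]

theorem weightedPrim_sin_pi (hf : EvenAntiperiodic f) : weightedPrim Real.sin f Real.pi = 0 := by
  have : IsAddTorsionFree E := .of_isTorsionFree ℝ E
  have hrefl s : Real.sin (Real.pi - s) • f (Real.pi - s) = -(Real.sin s • f s) := by
    rw [Real.sin_pi_sub, ← neg_sub, hf.even, hf.antiperiodic.sub_eq, smul_neg]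
  have h := intervalIntegral.integral_comp_sub_left
    (a := 0) (b := Real.pi) (fun s => Real.sin s • f s) Real.pi
  simp only [hrefl, sub_self, sub_zero, intervalIntegral.integral_neg] at h
  exact self_eq_neg.1 h.symm

theorem weightedPrim_cos_neg (hf : EvenAntiperiodic f) (θ : ℝ) :
    weightedPrim Real.cos f (-θ) = -weightedPrim Real.cos f θ := by
  simp only [weightedPrim_neg, Real.cos_neg, hf.even _]

theorem weightedPrim_sin_neg (hf : EvenAntiperiodic f) (θ : ℝ) :
    weightedPrim Real.sin f (-θ) = weightedPrim Real.sin f θ := by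
  rw [weightedPrim_neg]
  simp only [weightedPrim, Real.sin_neg, hf.even _, neg_smul, intervalIntegral.integral_neg,
    neg_neg]

theorem periodic_weightedPrim (hf : EvenAntiperiodic f) (hh : Continuous h)
    (hanti : Function.Antiperiodic h Real.pi) (h0 : weightedPrim h f Real.pi = 0) :
    Function.Periodic (weightedPrim h f) Real.pi := by
  intro θ
  have hcont : Continuous fun s => h s • f s := hh.smul hf.continuous
  have hper : Function.Periodic (fun s => h s • f s) Real.pi := fun s => by
    simp only [hanti s, hf.antiperiodic s, neg_smul_neg]
  have hshift := hper.intervalIntegral_add_eq θ 0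
  rw [zero_add] at hshift
  rw [weightedPrim, ← intervalIntegral.integral_add_adjacent_intervals (b := θ)
    (hcont.intervalIntegrable _ _) (hcont.intervalIntegrable _ _)]
  exact add_eq_left.2 (hshift.trans h0)

theorem norm_weightedPrim_le (hf : EvenAntiperiodic f) (hh : Continuous h)
    (hanti : Function.Antiperiodic h Real.pi) (hh1 : ∀ s, |h s| ≤ 1)
    (h0 : weightedPrim h f Real.pi = 0) (hC : ∀ s, ‖f s‖ ≤ C) (θ : ℝ) :
    ‖weightedPrim h f θ‖ ≤ Real.pi * C := by
  obtain ⟨y, hy, hθy⟩ :=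
    (hf.periodic_weightedPrim hh hanti h0).exists_mem_Ico₀ Real.pi_pos θ
  have hC0 : 0 ≤ C := (norm_nonneg _).trans (hC 0)
  rw [hθy]
  calc ‖weightedPrim h f y‖ ≤ C * |y| := norm_weightedPrim_le_mul_abs hh1 hC y
    _ ≤ Real.pi * C := by
        rw [abs_of_nonneg hy.1, mul_comm]
        gcongr
        exact hy.2.le

end EvenAntiperiodic

/-- The right-hand sides `f` for which `w'' + w = f` has an even `π`-antiperiodic solution. -/
structure Nonresonant (f : ℝ → E) : Prop extends EvenAntiperiodic f where
  cosCoeff_eq_zero : cosCoeff f = 0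

namespace Nonresonant

theorem zero : Nonresonant fun _ => (0 : E) where
  toEvenAntiperiodic := by simpa only [smul_zero] using EvenAntiperiodic.cos_smul (0 : E)
  cosCoeff_eq_zero := by simp [cosCoeff, weightedPrim]

theorem sub (hf : Nonresonant f) (hg : Nonresonant g) : Nonresonant fun s => f s - g s where
  toEvenAntiperiodic := hf.toEvenAntiperiodic.sub hg.toEvenAntiperiodic
  cosCoeff_eq_zero := by
    rw [cosCoeff_sub hf.continuous hg.continuous, hf.cosCoeff_eq_zero, hg.cosCoeff_eq_zero,
      sub_zero]

theorem add (hf : Nonresonant f) (hg : Nonresonant g) : Nonresonant fun s => f s + g s where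
  toEvenAntiperiodic := hf.toEvenAntiperiodic.add hg.toEvenAntiperiodic
  cosCoeff_eq_zero := by
    rw [cosCoeff_add hf.continuous hg.continuous, hf.cosCoeff_eq_zero, hg.cosCoeff_eq_zero,
      add_zero]

theorem const_smul {𝕜 : Type*} [NormedField 𝕜] [NormedSpace 𝕜 E] [SMulCommClass ℝ 𝕜 E]
    (c : 𝕜) (hf : Nonresonant f) : Nonresonant fun s => c • f s where
  toEvenAntiperiodic := hf.toEvenAntiperiodic.const_smul c
  cosCoeff_eq_zero := by rw [cosCoeff_const_smul, hf.cosCoeff_eq_zero, smul_zero]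

theorem weightedPrim_cos_pi (hf : Nonresonant f) : weightedPrim Real.cos f Real.pi = 0 := by
  simpa [cosCoeff, Real.pi_ne_zero] using hf.cosCoeff_eq_zero

theorem norm_weightedPrim_cos_le (hf : Nonresonant f) (hC : ∀ s, ‖f s‖ ≤ C) (θ : ℝ) :
    ‖weightedPrim Real.cos f θ‖ ≤ Real.pi * C :=
  hf.norm_weightedPrim_le Real.continuous_cos Real.cos_antiperiodic Real.abs_cos_le_one
    hf.weightedPrim_cos_pi hC θ

theorem norm_weightedPrim_sin_le (hf : Nonresonant f) (hC : ∀ s, ‖f s‖ ≤ C) (θ : ℝ) :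
    ‖weightedPrim Real.sin f θ‖ ≤ Real.pi * C :=
  hf.norm_weightedPrim_le Real.continuous_sin Real.sin_antiperiodic Real.abs_sin_le_one
    hf.weightedPrim_sin_pi hC θ

end Nonresonant

/-- The solution of `w'' + w = f` with vanishing Cauchy data at the origin. -/
def duhamel (f : ℝ → E) (θ : ℝ) : E :=
  Real.sin θ • weightedPrim Real.cos f θ - Real.cos θ • weightedPrim Real.sin f θ

/-- The derivative of `duhamel f`. -/
def duhamelDeriv (f : ℝ → E) (θ : ℝ) : E :=
  Real.cos θ • weightedPrim Real.cos f θ + Real.sin θ • weightedPrim Real.sin f θ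

/-- The solution of `w'' + w = f` with vanishing cosine coefficient and vanishing derivative at
the origin. -/
def green (f : ℝ → E) (θ : ℝ) : E := duhamel f θ - Real.cos θ • cosCoeff (duhamel f)

/-- The derivative of `green f`. -/
def greenDeriv (f : ℝ → E) (θ : ℝ) : E :=
  duhamelDeriv f θ + Real.sin θ • cosCoeff (duhamel f)

theorem duhamel_sub (hf : Continuous f) (hg : Continuous g) (θ : ℝ) :
    duhamel (fun s => f s - g s) θ = duhamel f θ - duhamel g θ := by
  simp only [duhamel, weightedPrim_sub Real.continuous_cos hf hg,
    weightedPrim_sub Real.continuous_sin hf hg, smul_sub]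
  abel

section Derivatives

variable [CompleteSpace E]

theorem hasDerivAt_duhamel (hf : Continuous f) (θ : ℝ) :
    HasDerivAt (duhamel f) (duhamelDeriv f θ) θ := by
  have hcos := hasDerivAt_weightedPrim Real.continuous_cos hf θ
  have hsin := hasDerivAt_weightedPrim Real.continuous_sin hf θ
  refine (((Real.hasDerivAt_sin θ).fun_smul hcos).fun_sub
    ((Real.hasDerivAt_cos θ).fun_smul hsin)).congr_deriv ?_
  rw [duhamelDeriv]
  module

theorem hasDerivAt_duhamelDeriv (hf : Continuous f) (θ : ℝ) :
    HasDerivAt (duhamelDeriv f) (-duhamel f θ + f θ) θ := by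
  have hcos := hasDerivAt_weightedPrim Real.continuous_cos hf θ
  have hsin := hasDerivAt_weightedPrim Real.continuous_sin hf θ
  refine (((Real.hasDerivAt_cos θ).fun_smul hcos).fun_add
    ((Real.hasDerivAt_sin θ).fun_smul hsin)).congr_deriv ?_
  have hpyth : (Real.cos θ ^ 2 + Real.sin θ ^ 2) • f θ = f θ := by
    rw [Real.cos_sq_add_sin_sq, one_smul]
  conv_rhs => rw [← hpyth, duhamel]
  module

theorem continuous_duhamel (hf : Continuous f) : Continuous (duhamel f) :=
  continuous_iff_continuousAt.2 fun θ => (hasDerivAt_duhamel hf θ).continuousAt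

theorem hasDerivAt_green (hf : Continuous f) (θ : ℝ) :
    HasDerivAt (green f) (greenDeriv f θ) θ := by
  refine ((hasDerivAt_duhamel hf θ).fun_sub
    ((Real.hasDerivAt_cos θ).smul_const (cosCoeff (duhamel f)))).congr_deriv ?_
  rw [greenDeriv, neg_smul, sub_neg_eq_add]

theorem hasDerivAt_greenDeriv (hf : Continuous f) (θ : ℝ) :
    HasDerivAt (greenDeriv f) (-green f θ + f θ) θ := by
  refine ((hasDerivAt_duhamelDeriv hf θ).fun_add
    ((Real.hasDerivAt_sin θ).smul_const (cosCoeff (duhamel f)))).congr_deriv ?_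
  rw [green]
  abel

theorem green_sub (hf : Continuous f) (hg : Continuous g) (θ : ℝ) :
    green (fun s => f s - g s) θ = green f θ - green g θ := by
  have hsub : duhamel (fun s => f s - g s) = fun θ => duhamel f θ - duhamel g θ :=
    funext (duhamel_sub hf hg)
  simp only [green, hsub, cosCoeff_sub (continuous_duhamel hf) (continuous_duhamel hg), smul_sub]
  abel

theorem cosCoeff_green (hf : Continuous f) : cosCoeff (green f) = 0 := by
  have hcos : Continuous fun s => Real.cos s • cosCoeff (duhamel f) := by fun_prop
  refine (cosCoeff_sub (continuous_duhamel hf) hcos).trans ?_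
  rw [cosCoeff_cos_smul, sub_self]

end Derivatives

theorem continuous_duhamel_uncurry {X : Type*} [TopologicalSpace X] {f : X → ℝ → E}
    (hf : Continuous (Function.uncurry f)) : Continuous fun p : X × ℝ => duhamel (f p.1) p.2 :=
  ((Real.continuous_sin.comp continuous_snd).smul
    (continuous_weightedPrim_uncurry Real.continuous_cos hf)).sub
    ((Real.continuous_cos.comp continuous_snd).smul
      (continuous_weightedPrim_uncurry Real.continuous_sin hf))

theorem continuous_greenDeriv_uncurry {X : Type*} [TopologicalSpace X] {f : X → ℝ → E}
    (hf : Continuous (Function.uncurry f)) :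
    Continuous fun p : X × ℝ => greenDeriv (f p.1) p.2 := by
  have hsin : Continuous fun p : X × ℝ => Real.sin p.2 := by fun_prop
  have hcos : Continuous fun p : X × ℝ => Real.cos p.2 := by fun_prop
  have hduhamelDeriv : Continuous fun p : X × ℝ => duhamelDeriv (f p.1) p.2 :=
    (hcos.smul (continuous_weightedPrim_uncurry Real.continuous_cos hf)).add
      (hsin.smul (continuous_weightedPrim_uncurry Real.continuous_sin hf))
  have hcoeff : Continuous fun x => cosCoeff (duhamel (f x)) :=
    continuous_cosCoeff (f := fun x => duhamel (f x)) (continuous_duhamel_uncurry hf)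
  exact hduhamelDeriv.add (hsin.smul (hcoeff.comp continuous_fst))

namespace Nonresonant

theorem evenAntiperiodic_duhamel [CompleteSpace E] (hf : Nonresonant f) :
    EvenAntiperiodic (duhamel f) where
  continuous := continuous_duhamel hf.continuous
  even θ := by
    simp only [duhamel, hf.weightedPrim_cos_neg, hf.weightedPrim_sin_neg, Real.sin_neg,
      Real.cos_neg, neg_smul_neg]
  antiperiodic θ := by
    have hcos := hf.periodic_weightedPrim Real.continuous_cos Real.cos_antiperiodic
      hf.weightedPrim_cos_pi θ
    have hsin := hf.periodic_weightedPrim Real.continuous_sin Real.sin_antiperiodic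
      hf.weightedPrim_sin_pi θ
    simp only [duhamel, hcos, hsin, Real.sin_add_pi, Real.cos_add_pi]
    module

protected theorem green [CompleteSpace E] (hf : Nonresonant f) : Nonresonant (green f) where
  toEvenAntiperiodic := hf.evenAntiperiodic_duhamel.sub (.cos_smul _)
  cosCoeff_eq_zero := cosCoeff_green hf.continuous

theorem norm_duhamel_le (hf : Nonresonant f) (hC : ∀ s, ‖f s‖ ≤ C) (θ : ℝ) :
    ‖duhamel f θ‖ ≤ 2 * Real.pi * C := by
  have hcos := norm_smul_le_of_abs_le_one (Real.abs_sin_le_one θ) (weightedPrim Real.cos f θ)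
  have hsin := norm_smul_le_of_abs_le_one (Real.abs_cos_le_one θ) (weightedPrim Real.sin f θ)
  refine (norm_sub_le _ _).trans ?_
  linarith [hf.norm_weightedPrim_cos_le hC θ, hf.norm_weightedPrim_sin_le hC θ]

theorem norm_duhamelDeriv_le (hf : Nonresonant f) (hC : ∀ s, ‖f s‖ ≤ C) (θ : ℝ) :
    ‖duhamelDeriv f θ‖ ≤ 2 * Real.pi * C := by
  have hcos := norm_smul_le_of_abs_le_one (Real.abs_cos_le_one θ) (weightedPrim Real.cos f θ)
  have hsin := norm_smul_le_of_abs_le_one (Real.abs_sin_le_one θ) (weightedPrim Real.sin f θ)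
  refine (norm_add_le _ _).trans ?_
  linarith [hf.norm_weightedPrim_cos_le hC θ, hf.norm_weightedPrim_sin_le hC θ]

theorem norm_green_le (hf : Nonresonant f) (hC : ∀ s, ‖f s‖ ≤ C) (θ : ℝ) :
    ‖green f θ‖ ≤ 6 * Real.pi * C := by
  have hcoeff := norm_cosCoeff_le (hf.norm_duhamel_le hC)
  have hcos := norm_smul_le_of_abs_le_one (Real.abs_cos_le_one θ) (cosCoeff (duhamel f))
  refine (norm_sub_le _ _).trans ?_
  linarith [hf.norm_duhamel_le hC θ]

theorem norm_greenDeriv_le (hf : Nonresonant f) (hC : ∀ s, ‖f s‖ ≤ C) (θ : ℝ) :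
    ‖greenDeriv f θ‖ ≤ 6 * Real.pi * C := by
  have hcoeff := norm_cosCoeff_le (hf.norm_duhamel_le hC)
  have hsin := norm_smul_le_of_abs_le_one (Real.abs_sin_le_one θ) (cosCoeff (duhamel f))
  refine (norm_add_le _ _).trans ?_
  linarith [hf.norm_duhamelDeriv_le hC θ]

end Nonresonant

end Resonance

section NonresonantSubmodule

variable (E : Type*) [NormedAddCommGroup E] [NormedSpace ℝ E]

/-- The bounded continuous functions that are nonresonant; this is where the corrections to the
linear oscillation live. -/
def nonresonantSubmodule : Submodule ℝ (ℝ →ᵇ E) where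
  carrier := {f | Nonresonant f}
  zero_mem' := Nonresonant.zero
  add_mem' := Nonresonant.add
  smul_mem' c _ := Nonresonant.const_smul c

theorem isClosed_nonresonantSubmodule : IsClosed (nonresonantSubmodule E : Set (ℝ →ᵇ E)) := by
  have heval (θ : ℝ) : Continuous fun f : ℝ →ᵇ E => f θ := continuous_eval_const θ
  have hcoeff : Continuous fun f : ℝ →ᵇ E => cosCoeff f :=
    continuous_cosCoeff (f := fun (f : ℝ →ᵇ E) s => f s) continuous_eval
  have hcarrier : (nonresonantSubmodule E : Set (ℝ →ᵇ E)) =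
      ((⋂ θ : ℝ, {f : ℝ →ᵇ E | f (-θ) = f θ}) ∩
        ⋂ θ : ℝ, {f : ℝ →ᵇ E | f (θ + Real.pi) = -f θ}) ∩ {f : ℝ →ᵇ E | cosCoeff f = 0} := by
    ext f
    simp only [Set.mem_inter_iff, Set.mem_iInter]
    exact ⟨fun h => ⟨⟨h.even, h.antiperiodic⟩, h.cosCoeff_eq_zero⟩,
      fun h => ⟨⟨f.continuous, h.1.1, h.1.2⟩, h.2⟩⟩
  rw [hcarrier]
  exact ((isClosed_iInter fun θ => isClosed_eq (heval _) (heval _)).inter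
    (isClosed_iInter fun θ => isClosed_eq (heval _) (heval _).neg)).inter
    (isClosed_eq hcoeff continuous_const)

instance [CompleteSpace E] : CompleteSpace (nonresonantSubmodule E) :=
  (isClosed_nonresonantSubmodule E).completeSpace_coe

end NonresonantSubmodule

section Cubic

variable {E : Type*} [NormedAddCommGroup E] [NormedSpace ℝ E] {R : ℝ} {z w : E}

/-- The cubic nonlinearity `|z|² z`. -/
def cub (z : E) : E := ‖z‖ ^ 2 • z

theorem continuous_cub : Continuous (cub : E → E) := by unfold cub; fun_prop

theorem odd_cub : Function.Odd (cub : E → E) := fun z => by simp [cub]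

theorem norm_cub (z : E) : ‖cub z‖ = ‖z‖ ^ 3 := by
  rw [cub, norm_smul, norm_pow, norm_norm]
  ring

theorem norm_cub_sub_le (hz : ‖z‖ ≤ R) (hw : ‖w‖ ≤ R) :
    ‖cub z - cub w‖ ≤ 3 * R ^ 2 * ‖z - w‖ := by
  have hR : 0 ≤ R := (norm_nonneg z).trans hz
  have hsq : |‖z‖ ^ 2 - ‖w‖ ^ 2| ≤ 2 * R * ‖z - w‖ := by
    rw [sq_sub_sq, abs_mul, abs_of_nonneg (by positivity)]
    gcongr
    · linarith
    · exact abs_norm_sub_norm_le z w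
  calc ‖cub z - cub w‖ = ‖‖z‖ ^ 2 • (z - w) + (‖z‖ ^ 2 - ‖w‖ ^ 2) • w‖ := by
        congr 1
        rw [cub, cub]
        module
    _ ≤ ‖z‖ ^ 2 * ‖z - w‖ + |‖z‖ ^ 2 - ‖w‖ ^ 2| * ‖w‖ := by
        refine (norm_add_le _ _).trans_eq ?_
        rw [norm_smul, norm_smul, norm_pow, norm_norm, Real.norm_eq_abs]
    _ ≤ R ^ 2 * ‖z - w‖ + 2 * R * ‖z - w‖ * R := by gcongr
    _ = 3 * R ^ 2 * ‖z - w‖ := by ring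

end Cubic

/-- `u` solves the oscillator equation `u'' = -p u + q |u|² u`, with derivative `u'`. -/
structure SolvesCubic (p q : ℂ) (u u' : ℝ → ℂ) : Prop where
  hasDerivAt : ∀ θ, HasDerivAt u (u' θ) θ
  hasDerivAt_deriv : ∀ θ, HasDerivAt u' (-p * u θ + q * cub (u θ)) θ

section Forcing

variable {ν : ℂ} {u w : ℝ → ℂ} {R C : ℝ}

/-- The cosine coefficient of `|u|² u`, that is, the frequency shift produced by the cubic term. -/
def cubicCoeff (u : ℝ → ℂ) : ℂ := cosCoeff fun s => cub (u s)

/-- The cubic term `ν |u|² u` with its resonant part removed. -/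
def forcing (ν : ℂ) (u : ℝ → ℂ) (θ : ℝ) : ℂ := ν * (cub (u θ) - cubicCoeff u * u θ)

theorem nonresonant_forcing (hu : EvenAntiperiodic u) (hcoeff : cosCoeff u = 1) :
    Nonresonant (forcing ν u) where
  toEvenAntiperiodic :=
    ((hu.comp_odd continuous_cub odd_cub).sub (hu.const_smul (cubicCoeff u))).const_smul ν
  cosCoeff_eq_zero := by
    have hcub : Continuous fun s => cub (u s) := continuous_cub.comp hu.continuous
    have hlin : Continuous fun s => cubicCoeff u • u s := hu.continuous.fun_const_smul _
    change cosCoeff (fun s => ν • (cub (u s) - cubicCoeff u • u s)) = 0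
    rw [cosCoeff_const_smul, cosCoeff_sub hcub hlin, cosCoeff_const_smul]
    simp only [hcoeff, cubicCoeff, smul_eq_mul, mul_one, sub_self, mul_zero]

theorem norm_cubicCoeff_le (hu : ∀ s, ‖u s‖ ≤ R) : ‖cubicCoeff u‖ ≤ 2 * R ^ 3 :=
  norm_cosCoeff_le fun s => (norm_cub (u s)).trans_le (by gcongr; exact hu s)

theorem norm_forcing_le (hu : ∀ s, ‖u s‖ ≤ R) (θ : ℝ) :
    ‖forcing ν u θ‖ ≤ ‖ν‖ * (R ^ 3 + 2 * R ^ 4) := by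
  have hcub : ‖cub (u θ)‖ ≤ R ^ 3 := (norm_cub _).trans_le (by gcongr; exact hu θ)
  rw [forcing, norm_mul]
  gcongr
  calc ‖cub (u θ) - cubicCoeff u * u θ‖ ≤ ‖cub (u θ)‖ + ‖cubicCoeff u‖ * ‖u θ‖ :=
        (norm_sub_le _ _).trans_eq (by rw [norm_mul])
    _ ≤ R ^ 3 + 2 * R ^ 3 * R := by
        have := (norm_nonneg _).trans (norm_cubicCoeff_le hu)
        gcongr
        exacts [norm_cubicCoeff_le hu, hu θ]
    _ = R ^ 3 + 2 * R ^ 4 := by ring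

theorem norm_cubicCoeff_sub_le (huc : Continuous u) (hwc : Continuous w)
    (hu : ∀ s, ‖u s‖ ≤ R) (hw : ∀ s, ‖w s‖ ≤ R) (hC : ∀ s, ‖u s - w s‖ ≤ C) :
    ‖cubicCoeff u - cubicCoeff w‖ ≤ 6 * R ^ 2 * C := by
  rw [cubicCoeff, cubicCoeff, ← cosCoeff_sub (continuous_cub.comp' huc) (continuous_cub.comp' hwc)]
  refine (norm_cosCoeff_le (C := 3 * R ^ 2 * C) fun s => ?_).trans_eq (by ring)
  exact (norm_cub_sub_le (hu s) (hw s)).trans (by gcongr; exact hC s)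

theorem norm_forcing_sub_le (huc : Continuous u) (hwc : Continuous w)
    (hu : ∀ s, ‖u s‖ ≤ R) (hw : ∀ s, ‖w s‖ ≤ R) (hC : ∀ s, ‖u s - w s‖ ≤ C) (θ : ℝ) :
    ‖forcing ν u θ - forcing ν w θ‖ ≤ ‖ν‖ * (3 * R ^ 2 + 8 * R ^ 3) * C := by
  have hR : 0 ≤ R := (norm_nonneg _).trans (hu 0)
  have hC0 : 0 ≤ C := (norm_nonneg _).trans (hC 0)
  have hsplit : forcing ν u θ - forcing ν w θ = ν * (cub (u θ) - cub (w θ)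
      - (cubicCoeff u - cubicCoeff w) * u θ - cubicCoeff w * (u θ - w θ)) := by
    simp only [forcing]
    ring
  have hcub : ‖cub (u θ) - cub (w θ)‖ ≤ 3 * R ^ 2 * C :=
    (norm_cub_sub_le (hu θ) (hw θ)).trans (by gcongr; exact hC θ)
  have hcoeff : ‖(cubicCoeff u - cubicCoeff w) * u θ‖ ≤ 6 * R ^ 2 * C * R := by
    rw [norm_mul]
    gcongr
    exacts [norm_cubicCoeff_sub_le huc hwc hu hw hC, hu θ]
  have hdiff : ‖cubicCoeff w * (u θ - w θ)‖ ≤ 2 * R ^ 3 * C := by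
    rw [norm_mul]
    gcongr
    exacts [norm_cubicCoeff_le hw, hC θ]
  rw [hsplit, norm_mul, mul_assoc]
  gcongr
  refine (norm_sub_le _ _).trans ?_
  linarith [norm_sub_le (cub (u θ) - cub (w θ)) ((cubicCoeff u - cubicCoeff w) * u θ)]

end Forcing

section EvenFamily

variable {v w : nonresonantSubmodule ℂ} {ν : ℂ} {t : ℝ}

/-- The perturbation `cos + v` of the linear oscillation. -/
def cosAdd (v : nonresonantSubmodule ℂ) (θ : ℝ) : ℂ := Real.cos θ + v.1 θ

theorem evenAntiperiodic_cosAdd (v : nonresonantSubmodule ℂ) : EvenAntiperiodic (cosAdd v) := by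
  simpa only [Complex.real_smul, mul_one] using!
    (EvenAntiperiodic.cos_smul (1 : ℂ)).add v.2.toEvenAntiperiodic

theorem cosCoeff_cosAdd (v : nonresonantSubmodule ℂ) : cosCoeff (cosAdd v) = 1 := by
  have hcos : Continuous fun s : ℝ => (Real.cos s : ℂ) := by fun_prop
  refine (cosCoeff_add hcos v.1.continuous).trans ?_
  rw [v.2.cosCoeff_eq_zero, add_zero]
  simpa using cosCoeff_cos_smul (1 : ℂ)

theorem norm_cosAdd_le (hv : ‖v‖ ≤ 1) (s : ℝ) : ‖cosAdd v s‖ ≤ 2 := by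
  have hcos : ‖(Real.cos s : ℂ)‖ ≤ 1 := by
    rw [Complex.norm_real]
    exact Real.abs_cos_le_one s
  have hvs : ‖v.1 s‖ ≤ 1 := (v.1.norm_coe_le_norm s).trans hv
  exact (norm_add_le _ _).trans (by linarith)

theorem nonresonant_forcing_cosAdd (ν : ℂ) (v : nonresonantSubmodule ℂ) :
    Nonresonant (forcing ν (cosAdd v)) :=
  nonresonant_forcing (evenAntiperiodic_cosAdd v) (cosCoeff_cosAdd v)

/-- The Lyapunov-Schmidt map: `cos + v` solves the oscillator equation with cubic coefficient `t ν`
and linear coefficient adjusted to remove the resonance when `v = t • fixMap ν v`. -/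
def fixMap (ν : ℂ) (v : nonresonantSubmodule ℂ) : nonresonantSubmodule ℂ :=
  have hgreen := (nonresonant_forcing_cosAdd ν v).green
  ⟨.ofNormedAddCommGroup (green (forcing ν (cosAdd v))) hgreen.continuous
    hgreen.exists_norm_le.choose hgreen.exists_norm_le.choose_spec, hgreen⟩

theorem fixMap_apply (ν : ℂ) (v : nonresonantSubmodule ℂ) (θ : ℝ) :
    (fixMap ν v).1 θ = green (forcing ν (cosAdd v)) θ := rfl

theorem norm_fixMap_le (hv : ‖v‖ ≤ 1) : ‖fixMap ν v‖ ≤ 240 * Real.pi * ‖ν‖ := by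
  refine (BoundedContinuousFunction.norm_le (by positivity)).2 fun θ => ?_
  exact ((nonresonant_forcing_cosAdd ν v).norm_green_le
    (norm_forcing_le (norm_cosAdd_le hv)) θ).trans_eq (by ring)

theorem norm_fixMap_sub_le (hv : ‖v‖ ≤ 1) (hw : ‖w‖ ≤ 1) :
    ‖fixMap ν v - fixMap ν w‖ ≤ 456 * Real.pi * ‖ν‖ * ‖v - w‖ := by
  have hnv := nonresonant_forcing_cosAdd ν v
  have hnw := nonresonant_forcing_cosAdd ν w
  have hdist s : ‖cosAdd v s - cosAdd w s‖ ≤ ‖v - w‖ := by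
    rw [cosAdd, cosAdd, add_sub_add_left_eq_sub]
    exact (v - w).1.norm_coe_le_norm s
  have hforcing := norm_forcing_sub_le (ν := ν) (evenAntiperiodic_cosAdd v).continuous
    (evenAntiperiodic_cosAdd w).continuous (norm_cosAdd_le hv) (norm_cosAdd_le hw) hdist
  refine (BoundedContinuousFunction.norm_le (by positivity)).2 fun θ => ?_
  change ‖green (forcing ν (cosAdd v)) θ - green (forcing ν (cosAdd w)) θ‖ ≤ _
  rw [← green_sub hnv.continuous hnw.continuous]
  exact ((hnv.sub hnw).norm_green_le hforcing θ).trans_eq (by ring)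

/-- The derivative of `cosAdd v` when `v = t • fixMap ν v`. -/
def cosAddDeriv (ν : ℂ) (t : ℝ) (v : nonresonantSubmodule ℂ) (θ : ℝ) : ℂ :=
  -Real.sin θ + t * greenDeriv (forcing ν (cosAdd v)) θ

theorem solvesCubic_cosAdd (hv : v = t • fixMap ν v) :
    SolvesCubic (1 + t * ν * cubicCoeff (cosAdd v)) (t * ν) (cosAdd v) (cosAddDeriv ν t v) := by
  have hf := (nonresonant_forcing_cosAdd ν v).continuous
  have hfix θ : cosAdd v θ = Real.cos θ + t * green (forcing ν (cosAdd v)) θ := by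
    conv_lhs => rw [cosAdd, hv]
    simp [fixMap_apply]
  constructor
  · intro θ
    have hcos : HasDerivAt (fun s : ℝ => (Real.cos s : ℂ)) (-Real.sin θ : ℂ) θ := by
      simpa using! (Real.hasDerivAt_cos θ).ofReal_comp
    exact (hcos.fun_add ((hasDerivAt_green hf θ).const_mul (t : ℂ))).congr_of_eventuallyEq
      (.of_forall hfix)
  · intro θ
    refine ((Real.hasDerivAt_sin θ).ofReal_comp.fun_neg.fun_add
      ((hasDerivAt_greenDeriv hf θ).const_mul (t : ℂ))).congr_deriv ?_
    have hθ := hfix θ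
    simp only [forcing] at hθ ⊢
    linear_combination hθ

theorem norm_cosAddDeriv_add_sin_le (hv : ‖v‖ ≤ 1) (θ : ℝ) :
    ‖cosAddDeriv ν t v θ + Real.sin θ‖ ≤ |t| * (240 * Real.pi * ‖ν‖) := by
  rw [cosAddDeriv, neg_add_eq_sub, sub_add_cancel, norm_mul, Complex.norm_real, Real.norm_eq_abs]
  gcongr
  exact ((nonresonant_forcing_cosAdd ν v).norm_greenDeriv_le
    (norm_forcing_le (norm_cosAdd_le hv)) θ).trans_eq (by ring)

theorem continuous_uncurry_cosAdd {X : Type*} [TopologicalSpace X]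
    {v : X → nonresonantSubmodule ℂ} (hv : Continuous v) :
    Continuous (Function.uncurry fun x => cosAdd (v x)) := by
  have hcos : Continuous fun p : X × ℝ => (Real.cos p.2 : ℂ) := by fun_prop
  exact hcos.add (((continuous_subtype_val.comp hv).comp continuous_fst).eval continuous_snd)

theorem continuous_cubicCoeff_cosAdd {X : Type*} [TopologicalSpace X]
    {v : X → nonresonantSubmodule ℂ} (hv : Continuous v) :
    Continuous fun x => cubicCoeff (cosAdd (v x)) :=
  continuous_cosCoeff (f := fun x s => cub (cosAdd (v x) s))
    (continuous_cub.comp (continuous_uncurry_cosAdd hv))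

theorem continuous_uncurry_cosAddDeriv {v : ℝ → nonresonantSubmodule ℂ} (hv : Continuous v) :
    Continuous (Function.uncurry fun t => cosAddDeriv ν t (v t)) := by
  have hforcing : Continuous (Function.uncurry fun t => forcing ν (cosAdd (v t))) :=
    continuous_const.mul ((continuous_cub.comp (continuous_uncurry_cosAdd hv)).sub
      (((continuous_cubicCoeff_cosAdd hv).comp continuous_fst).mul (continuous_uncurry_cosAdd hv)))
  have hsin : Continuous fun p : ℝ × ℝ => -(Real.sin p.2 : ℂ) := by fun_prop
  have ht : Continuous fun p : ℝ × ℝ => (p.1 : ℂ) := by fun_prop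
  exact hsin.add (ht.mul (continuous_greenDeriv_uncurry
    (f := fun t => forcing ν (cosAdd (v t))) hforcing))

theorem cubicCoeff_cos : cubicCoeff (fun s => (Real.cos s : ℂ)) = 3 / 4 := by
  have hint (s : ℝ) : Real.cos s • cub (Real.cos s : ℂ) = ((Real.cos s ^ 4 : ℝ) : ℂ) := by
    simp only [cub, Complex.norm_real, Real.norm_eq_abs, sq_abs, Complex.real_smul]
    push_cast
    ring
  have hmoment : ∫ s in (0 : ℝ)..Real.pi, Real.cos s ^ 4 = 3 * Real.pi / 8 := by
    rw [integral_cos_pow, integral_cos_sq]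
    norm_num
    ring
  have hscale : 2 / Real.pi * (3 * Real.pi / 8) = 3 / 4 := by
    field_simp
    norm_num
  simp only [cubicCoeff, cosCoeff, weightedPrim, hint, intervalIntegral.integral_ofReal, hmoment]
  rw [Complex.real_smul, ← Complex.ofReal_mul, hscale]
  norm_num

end EvenFamily

section Division

variable {E : Type*} [NormedAddCommGroup E] [NormedSpace ℝ E] {f g : ℝ → E} {f' : ℝ → E} {n : ℕ}

theorem contDiff_succ_of_hasDerivAt (hf : ∀ x, HasDerivAt f (f' x) x) (hf' : ContDiff ℝ n f') :
    ContDiff ℝ (n + 1) f := by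
  have hderiv : deriv f = f' := funext fun x => (hf x).deriv
  exact contDiff_succ_iff_deriv.2 ⟨fun x => (hf x).differentiableAt, by simp, by rwa [hderiv]⟩

theorem hasDerivAt_integral_pow_smul (hg : ContDiff ℝ 1 g) (k : ℕ) (c x : ℝ) :
    HasDerivAt (fun x => ∫ s in (0 : ℝ)..1, s ^ k • g (c + s * (x - c)))
      (∫ s in (0 : ℝ)..1, s ^ (k + 1) • deriv g (c + s * (x - c))) x := by
  have hgc : Continuous g := hg.continuous
  have : Continuous (deriv g) := hg.continuous_deriv_one
  have hF y : Continuous fun s : ℝ => s ^ k • g (c + s * (y - c)) := by fun_prop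
  have hF' : Continuous fun p : ℝ × ℝ => p.2 ^ (k + 1) • deriv g (c + p.2 * (p.1 - c)) := by
    fun_prop
  obtain ⟨C, hC⟩ := ((isCompact_closedBall x 1).prod
    (isCompact_Icc (a := (0 : ℝ)) (b := 1))).exists_bound_of_continuousOn hF'.continuousOn
  refine (intervalIntegral.hasDerivAt_integral_of_dominated_loc_of_deriv_le
    (F' := fun x s => s ^ (k + 1) • deriv g (c + s * (x - c))) (bound := fun _ => C)
    (Metric.closedBall_mem_nhds x one_pos)
    (.of_forall fun y => (hF y).aestronglyMeasurable) ((hF x).intervalIntegrable _ _)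
    (hF'.comp (Continuous.prodMk_right x)).aestronglyMeasurable
    (.of_forall fun s hs y hy => ?_) intervalIntegrable_const (.of_forall fun s _ y _ => ?_)).2
  · rw [Set.uIoc_of_le zero_le_one] at hs
    exact hC (y, s) ⟨hy, hs.1.le, hs.2⟩
  · have hline : HasDerivAt (fun y => c + s * (y - c)) s y := by
      simpa using (((hasDerivAt_id y).sub_const c).const_mul s).const_add c
    have hgd := (hg.differentiable_one (c + s * (y - c))).hasDerivAt
    refine ((hgd.scomp y hline).const_smul (s ^ k)).congr_deriv ?_
    rw [smul_smul, pow_succ]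

theorem contDiff_integral_pow_smul (hg : ContDiff ℝ n g) (k : ℕ) (c : ℝ) :
    ContDiff ℝ n fun x => ∫ s in (0 : ℝ)..1, s ^ k • g (c + s * (x - c)) := by
  induction n generalizing k g with
  | zero =>
    have hgc : Continuous g := hg.continuous
    rw [Nat.cast_zero, contDiff_zero]
    exact intervalIntegral.continuous_parametric_intervalIntegral_of_continuous'
      (f := fun x s => s ^ k • g (c + s * (x - c))) (by fun_prop) 0 1
  | succ n ih =>
    rw [Nat.cast_succ] at hg ⊢
    have hg1 : ContDiff ℝ 1 g := hg.of_le (by simp)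
    exact contDiff_succ_of_hasDerivAt (hasDerivAt_integral_pow_smul hg1 k c)
      (ih (contDiff_succ_iff_deriv.1 hg).2.2 (k + 1))

theorem exists_contDiff_sub_smul [CompleteSpace E] {c : ℝ} (hf : ContDiff ℝ (n + 1) f)
    (hc : f c = 0) :
    ∃ g : ℝ → E, ContDiff ℝ n g ∧ g c = deriv f c ∧ ∀ x, f x = (x - c) • g x := by
  have hf' : ContDiff ℝ n (deriv f) := (contDiff_succ_iff_deriv.1 hf).2.2
  have hfd : Differentiable ℝ f := (contDiff_succ_iff_deriv.1 hf).1
  refine ⟨_, contDiff_integral_pow_smul hf' 0 c, by simp, fun x => ?_⟩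
  have hline (s : ℝ) : HasDerivAt (fun s => f (c + s * (x - c)))
      ((x - c) • s ^ 0 • deriv f (c + s * (x - c))) s := by
    have := ((hasDerivAt_id s).mul_const (x - c)).const_add c
    simpa [Function.comp_def] using (hfd (c + s * (x - c))).hasDerivAt.scomp s this
  have hcont : Continuous fun s => (x - c) • s ^ 0 • deriv f (c + s * (x - c)) := by
    have := hf'.continuous
    fun_prop
  rw [← intervalIntegral.integral_smul, intervalIntegral.integral_eq_sub_of_hasDerivAt
    (fun s _ => hline s) (hcont.intervalIntegrable 0 1)]
  simp [hc]

end Division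

section Quotient

variable {E : Type*} [NormedAddCommGroup E] [NormedSpace ℝ E] {f : ℝ → E} {g : ℝ → ℝ} {T : ℝ}

/-- The quotient `f / g`, extended to the zeros of `g` by l'Hôpital's rule. -/
def extQuot (f : ℝ → E) (g : ℝ → ℝ) (x : ℝ) : E :=
  if g x = 0 then (deriv g x)⁻¹ • deriv f x else (g x)⁻¹ • f x

theorem smul_extQuot {x : ℝ} (h : g x = 0 → f x = 0) : g x • extQuot f g x = f x := by
  by_cases hg : g x = 0
  · rw [hg, zero_smul, h hg]
  · rw [extQuot, if_neg hg, smul_inv_smul₀ hg]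

theorem even_extQuot (hf : Function.Even f) (hg : Function.Even g) :
    Function.Even (extQuot f g) := by
  intro x
  have hf' : deriv f (-x) = -deriv f x := by
    have h := deriv_comp_neg (f := f) (x := x)
    rw [show (fun s => f (-s)) = f from funext hf] at h
    rw [h, neg_neg]
  have hg' : deriv g (-x) = -deriv g x := by
    have h := deriv_comp_neg (f := g) (x := x)
    rw [show (fun s => g (-s)) = g from funext hg] at h
    rw [h, neg_neg]
  simp only [extQuot, hf x, hg x, hf', hg', inv_neg, neg_smul_neg]

theorem periodic_extQuot (hf : Function.Antiperiodic f T) (hg : Function.Antiperiodic g T) :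
    Function.Periodic (extQuot f g) T := by
  intro x
  have hf' : deriv f (x + T) = -deriv f x := by
    rw [← deriv_comp_add_const, funext hf, deriv.fun_neg]
  have hg' : deriv g (x + T) = -deriv g x := by
    rw [← deriv_comp_add_const, funext hg, deriv.fun_neg]
  simp only [extQuot, hf x, hg x, hf', hg', inv_neg, neg_smul_neg, neg_eq_zero]

theorem contDiff_extQuot [CompleteSpace E] {n : ℕ} (hf : ContDiff ℝ (n + 1) f)
    (hg : ContDiff ℝ (n + 1) g) (hzero : ∀ x, g x = 0 → f x = 0)
    (hsimple : ∀ x, g x = 0 → deriv g x ≠ 0) : ContDiff ℝ n (extQuot f g) := by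
  refine contDiff_iff_contDiffAt.2 fun c => ?_
  by_cases hc : g c = 0
  · obtain ⟨F, hF, hFc, hF'⟩ := exists_contDiff_sub_smul hf (hzero c hc)
    obtain ⟨G, hG, hGc, hG'⟩ := exists_contDiff_sub_smul hg hc
    have hGc0 : G c ≠ 0 := hGc ▸ hsimple c hc
    refine ((hG.contDiffAt.inv hGc0).smul hF.contDiffAt).congr_of_eventuallyEq ?_
    filter_upwards [hG.continuous.continuousAt.eventually_ne hGc0] with x hx
    change extQuot f g x = (G x)⁻¹ • F x
    rcases eq_or_ne x c with rfl | hxc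
    · rw [extQuot, if_pos hc, hFc, hGc]
    · have hxc' : x - c ≠ 0 := sub_ne_zero.2 hxc
      have hgx : g x ≠ 0 := hG' x ▸ smul_ne_zero hxc' hx
      rw [extQuot, if_neg hgx, hG', hF', smul_eq_mul, mul_inv, mul_comm, mul_smul,
        inv_smul_smul₀ hxc']
  · have hle : (n : WithTop ℕ∞) ≤ n + 1 := by exact_mod_cast n.le_succ
    refine ((hg.of_le hle).contDiffAt.inv hc).smul (hf.of_le hle).contDiffAt
      |>.congr_of_eventuallyEq ?_
    filter_upwards [hg.continuous.continuousAt.eventually_ne hc] with x hx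
    exact if_neg hx

end Quotient

section CosineQuotient

variable {E : Type*} [NormedAddCommGroup E] [NormedSpace ℝ E] {u : ℝ → E} {e : E} {C : ℝ}

theorem EvenAntiperiodic.eq_zero_of_cos_eq_zero (hu : EvenAntiperiodic u) {θ : ℝ}
    (hθ : Real.cos θ = 0) : u θ = 0 := by
  have : IsAddTorsionFree E := .of_isTorsionFree ℝ E
  obtain ⟨k, rfl⟩ := Real.cos_eq_zero_iff.1 hθ
  set θ := (2 * k + 1) * Real.pi / 2 with hθk
  have hshift : -θ + (k * (2 * Real.pi) + Real.pi) = θ := by rw [hθk]; ring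
  have hanti := hu.antiperiodic.int_odd_mul_antiperiodic k (-θ)
  rw [hshift, hu.even] at hanti
  exact self_eq_neg.1 hanti

theorem EvenAntiperiodic.norm_le_mul_abs_cos (hu : EvenAntiperiodic u) (hd : Differentiable ℝ u)
    (hC : ∀ θ, ‖deriv u θ‖ ≤ C) (θ : ℝ) : ‖u θ‖ ≤ Real.pi / 2 * C * |Real.cos θ| := by
  have hC0 : 0 ≤ C := (norm_nonneg _).trans (hC 0)
  have hquarter (y : ℝ) (hy : 0 ≤ y) (hy' : y ≤ Real.pi / 2) :
      ‖u y‖ ≤ Real.pi / 2 * C * |Real.cos y| := by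
    have hmean := convex_univ.norm_image_sub_le_of_norm_deriv_le (fun s _ => hd s)
      (fun s _ => hC s) (Set.mem_univ (Real.pi / 2)) (Set.mem_univ y)
    rw [hu.eq_zero_of_cos_eq_zero Real.cos_pi_div_two, sub_zero, Real.norm_eq_abs, abs_sub_comm,
      abs_of_nonneg (by linarith)] at hmean
    have hjordan := Real.mul_le_sin (x := Real.pi / 2 - y) (by linarith) (by linarith)
    rw [Real.sin_pi_div_two_sub] at hjordan
    calc ‖u y‖ ≤ Real.pi / 2 * C * (2 / Real.pi * (Real.pi / 2 - y)) := by
          refine hmean.trans_eq ?_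
          field_simp
      _ ≤ Real.pi / 2 * C * |Real.cos y| := by
          gcongr
          exact hjordan.trans (le_abs_self _)
  have hper : Function.Periodic (fun s => (‖u s‖, |Real.cos s|)) Real.pi := fun s => by
    simp only [hu.antiperiodic s, norm_neg, Real.cos_add_pi, abs_neg]
  obtain ⟨y, hy, hθy⟩ := hper.exists_mem_Ico Real.pi_pos θ (-(Real.pi / 2))
  obtain ⟨hnorm, hcos⟩ := Prod.mk.inj hθy
  have habs : u y = u |y| := by
    rcases abs_choice y with h | h <;> rw [h]
    rw [hu.even]
  rw [hnorm, hcos, habs, ← Real.cos_abs y]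
  exact hquarter _ (abs_nonneg y) (abs_le.2 ⟨hy.1, by linarith [hy.2]⟩)

theorem EvenAntiperiodic.norm_extQuot_cos_sub_le (hu : EvenAntiperiodic u)
    (hd : Differentiable ℝ u) (hC : ∀ θ, ‖deriv u θ + Real.sin θ • e‖ ≤ C) (θ : ℝ) :
    ‖extQuot u Real.cos θ - e‖ ≤ Real.pi / 2 * C := by
  have hderiv s : HasDerivAt (fun s => u s - Real.cos s • e) (deriv u s + Real.sin s • e) s := by
    simpa using! (hd s).hasDerivAt.fun_sub ((Real.hasDerivAt_cos s).smul_const e)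
  by_cases hθ : Real.cos θ = 0
  · have hsin : |Real.sin θ| = 1 := by
      simp [Real.abs_sin_eq_sqrt_one_sub_cos_sq, hθ]
    have hsin0 : Real.sin θ ≠ 0 := abs_pos.1 (hsin ▸ one_pos)
    have hval : extQuot u Real.cos θ - e = (-Real.sin θ)⁻¹ • (deriv u θ + Real.sin θ • e) := by
      rw [extQuot, if_pos hθ, Real.deriv_cos, smul_add, inv_neg, neg_smul, neg_smul,
        inv_smul_smul₀ hsin0, sub_eq_add_neg]
    calc ‖extQuot u Real.cos θ - e‖ ≤ 1 * C := by
          rw [hval, norm_smul, norm_inv, norm_neg, Real.norm_eq_abs, hsin, inv_one, one_mul,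
            one_mul]
          exact hC θ
      _ ≤ Real.pi / 2 * C := by
          have := (norm_nonneg _).trans (hC 0)
          gcongr
          linarith [Real.pi_gt_three]
  · have hval : extQuot u Real.cos θ - e = (Real.cos θ)⁻¹ • (u θ - Real.cos θ • e) := by
      rw [extQuot, if_neg hθ, smul_sub, inv_smul_smul₀ hθ]
    have hsub := (hu.sub (EvenAntiperiodic.cos_smul e)).norm_le_mul_abs_cos
      (fun s => (hderiv s).differentiableAt) (fun s => by rw [(hderiv s).deriv]; exact hC s) θ
    rw [hval, norm_smul, norm_inv, Real.norm_eq_abs, inv_mul_le_iff₀ (abs_pos.2 hθ)]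
    exact hsub.trans_eq (mul_comm _ _)

end CosineQuotient

theorem contDiff_cub {E : Type*} [NormedAddCommGroup E] [InnerProductSpace ℝ E] {n : WithTop ℕ∞} :
    ContDiff ℝ n (cub : E → E) :=
  (contDiff_norm_sq ℝ).smul contDiff_id

theorem SolvesCubic.contDiff {p q : ℂ} {u u' : ℝ → ℂ} (hu : SolvesCubic p q u u') (n : ℕ) :
    ContDiff ℝ n u := by
  suffices h : ContDiff ℝ n u ∧ ContDiff ℝ n u' from h.1
  induction n with
  | zero =>
    simp only [Nat.cast_zero, contDiff_zero]
    exact ⟨continuous_iff_continuousAt.2 fun θ => (hu.hasDerivAt θ).continuousAt,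
      continuous_iff_continuousAt.2 fun θ => (hu.hasDerivAt_deriv θ).continuousAt⟩
  | succ n ih =>
    rw [Nat.cast_succ]
    exact ⟨contDiff_succ_of_hasDerivAt hu.hasDerivAt ih.2,
      contDiff_succ_of_hasDerivAt hu.hasDerivAt_deriv
        ((contDiff_const.mul ih.1).add (contDiff_const.mul (contDiff_cub.comp ih.1)))⟩

/-- A polar decomposition `u = S exp (i ψ)` of class `C²` by a real amplitude `S`, which may change
sign, and a phase `ψ`. The symmetries of `u` are put on `S` and `ψ`: the sign `-σ` is the parity
of `S`, and `T` is its antiperiod. -/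
structure PolarForm (σ T : ℝ) (u : ℝ → ℂ) (S ψ : ℝ → ℝ) : Prop where
  contDiff_amplitude : ContDiff ℝ 2 S
  contDiff_phase : ContDiff ℝ 2 ψ
  eq_polar : ∀ x, u x = S x * Complex.exp (Complex.I * ψ x)
  amplitude_neg : ∀ x, S (-x) = -σ * S x
  antiperiodic_amplitude : Function.Antiperiodic S T
  even_phase : Function.Even ψ
  periodic_phase : Function.Periodic ψ T

namespace PolarForm

variable {σ T : ℝ} {u : ℝ → ℂ} {S ψ : ℝ → ℝ}

theorem apply_neg (h : PolarForm σ T u S ψ) (x : ℝ) : u (-x) = -σ * u x := by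
  rw [h.eq_polar, h.eq_polar, h.amplitude_neg, h.even_phase]
  push_cast
  ring

theorem antiperiodic (h : PolarForm σ T u S ψ) : Function.Antiperiodic u T := fun x => by
  rw [h.eq_polar, h.eq_polar, h.antiperiodic_amplitude, h.periodic_phase, Complex.ofReal_neg,
    neg_mul]

theorem normSq_eq (h : PolarForm σ T u S ψ) (x : ℝ) : Complex.normSq (u x) = S x ^ 2 := by
  rw [h.eq_polar, Complex.normSq_mul, Complex.normSq_ofReal, Complex.normSq_eq_norm_sq,
    mul_comm Complex.I, Complex.norm_exp_ofReal_mul_I]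
  ring

theorem const_mul (h : PolarForm σ T u S ψ) (c : ℝ) :
    PolarForm σ T (fun x => c * u x) (fun x => c * S x) ψ where
  contDiff_amplitude := contDiff_const.mul h.contDiff_amplitude
  contDiff_phase := h.contDiff_phase
  eq_polar x := by rw [h.eq_polar, Complex.ofReal_mul, mul_assoc]
  amplitude_neg x := by rw [h.amplitude_neg, mul_left_comm]
  antiperiodic_amplitude x := by simp only [h.antiperiodic_amplitude x, mul_neg]
  even_phase := h.even_phase
  periodic_phase := h.periodic_phase

theorem comp_mul_left (h : PolarForm σ T u S ψ) {k : ℝ} (hk : k ≠ 0) :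
    PolarForm σ (T / k) (fun x => u (k * x)) (fun x => S (k * x)) fun x => ψ (k * x) where
  contDiff_amplitude := h.contDiff_amplitude.comp (contDiff_const.mul contDiff_id)
  contDiff_phase := h.contDiff_phase.comp (contDiff_const.mul contDiff_id)
  eq_polar x := h.eq_polar _
  amplitude_neg x := by rw [mul_neg, h.amplitude_neg]
  antiperiodic_amplitude x := by
    simp only [mul_add, mul_div_cancel₀ _ hk, h.antiperiodic_amplitude (k * x)]
  even_phase x := by simp only [mul_neg, h.even_phase (k * x)]
  periodic_phase x := by simp only [mul_add, mul_div_cancel₀ _ hk, h.periodic_phase (k * x)]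

theorem shift (h : PolarForm σ T u S ψ) : PolarForm (-σ) T (fun x => u (x + T / 2))
    (fun x => S (x + T / 2)) fun x => ψ (x + T / 2) where
  contDiff_amplitude := h.contDiff_amplitude.comp (contDiff_id.add contDiff_const)
  contDiff_phase := h.contDiff_phase.comp (contDiff_id.add contDiff_const)
  eq_polar x := h.eq_polar _
  amplitude_neg x := by
    rw [show -x + T / 2 = -(x + T / 2) + T by ring, h.antiperiodic_amplitude, h.amplitude_neg,
      neg_mul (-σ)]
  antiperiodic_amplitude x := by
    simp only [add_right_comm x T, h.antiperiodic_amplitude (x + T / 2)]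
  even_phase x := by
    beta_reduce
    rw [show -x + T / 2 = -(x + T / 2) + T by ring, h.periodic_phase, h.even_phase]
  periodic_phase x := by
    simp only [add_right_comm x T, h.periodic_phase (x + T / 2)]

end PolarForm

theorem exists_polarForm {u : ℝ → ℂ} (hu : EvenAntiperiodic u) (hu3 : ContDiff ℝ 3 u)
    (hsin : ∀ θ, ‖deriv u θ + Real.sin θ‖ ≤ 1 / 2) : ∃ S ψ, PolarForm (-1) Real.pi u S ψ := by
  set Q := extQuot u Real.cos
  have hQ2 : ContDiff ℝ 2 Q := by
    refine contDiff_extQuot (n := 2) (by norm_num; exact hu3) Real.contDiff_cos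
      (fun θ => hu.eq_zero_of_cos_eq_zero) fun θ hθ => ?_
    rw [Real.deriv_cos, neg_ne_zero]
    intro hθ'
    simpa [hθ, hθ'] using Real.cos_sq_add_sin_sq θ
  have hnear θ : ‖Q θ - 1‖ < 1 := by
    refine (hu.norm_extQuot_cos_sub_le (hu3.differentiable (by simp)) (e := (1 : ℂ)) (C := 1 / 2)
      (fun s => by simpa using hsin s) θ).trans_lt ?_
    linarith [Real.pi_lt_four]
  have hslit θ : Q θ ∈ Complex.slitPlane := by
    simpa only [add_sub_cancel] using Complex.mem_slitPlane_of_norm_lt_one (hnear θ)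
  have hne θ : Q θ ≠ 0 := Complex.slitPlane_ne_zero (hslit θ)
  have heven : Function.Even Q := even_extQuot hu.even Real.cos_neg
  have hper : Function.Periodic Q Real.pi := periodic_extQuot hu.antiperiodic Real.cos_antiperiodic
  refine ⟨fun θ => Real.cos θ * ‖Q θ‖, fun θ => (Complex.log (Q θ)).im,
    Real.contDiff_cos.mul (hQ2.norm ℝ hne), ?_, fun θ => ?_, fun θ => ?_, fun θ => ?_,
    fun θ => by simp only [heven θ], fun θ => by simp only [hper θ]⟩
  · exact Complex.imCLM.contDiff.comp (f := fun θ => Complex.log (Q θ))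
      (contDiff_iff_contDiffAt.2 fun θ =>
        ((Complex.contDiffAt_log (hslit θ)).restrict_scalars ℝ).comp θ hQ2.contDiffAt)
  · rw [Complex.log_im, mul_comm Complex.I, Complex.ofReal_mul, mul_assoc,
      Complex.norm_mul_exp_arg_mul_I, ← Complex.real_smul]
    exact (smul_extQuot fun h => hu.eq_zero_of_cos_eq_zero h).symm
  · simp only [Real.cos_neg, heven θ]
    ring
  · simp only [Real.cos_add_pi, hper θ, neg_mul]

/-- A continuous family of `π`-antiperiodic solutions `u t` of
`u'' + (1 + t ν r(t)) u = t ν |u|² u`, starting from `cos (θ + shift)` at `t = 0`. The sign `-σ`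
is their parity, and `shift` is fixed modulo `π` by `cos (2 shift) = -σ`. -/
structure ProfileFamily (ν : ℂ) (σ : ℝ) where
  radius : ℝ
  radius_pos : 0 < radius
  shift : ℝ
  u : ℝ → ℝ → ℂ
  u' : ℝ → ℝ → ℂ
  r : ℝ → ℂ
  cos_two_mul_shift : Real.cos (2 * shift) = -σ
  sin_two_mul_shift : Real.sin (2 * shift) = 0
  continuous_u : Continuous (Function.uncurry u)
  continuous_u' : Continuous (Function.uncurry u')
  continuous_r : Continuous r
  u_zero : ∀ θ, u 0 θ = Real.cos (θ + shift)
  u'_zero : ∀ θ, u' 0 θ = -Real.sin (θ + shift)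
  r_zero : r 0 = 3 / 4
  solvesCubic : ∀ t, |t| ≤ radius → SolvesCubic (1 + t * ν * r t) (t * ν) (u t) (u' t)
  exists_polarForm : ∀ t, |t| ≤ radius → ∃ S ψ, PolarForm σ Real.pi (u t) S ψ
  exists_eq_zero : ∀ t, |t| ≤ radius → ∃ θ, u t θ = 0
  exists_ne_zero : ∀ t, |t| ≤ radius → ∃ θ, u t θ ≠ 0

theorem exists_continuous_eq_smul_fixMap (ν : ℂ) :
    ∃ t₀ > 0, t₀ * (240 * Real.pi * ‖ν‖) ≤ 1 / 2 ∧
      ∃ v : ℝ → nonresonantSubmodule ℂ, Continuous v ∧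
        ∀ t, |t| ≤ t₀ → ‖v t‖ ≤ 1 ∧ v t = t • fixMap ν (v t) := by
  set L := 456 * Real.pi * ‖ν‖ with hL
  have : 0 ≤ L := by positivity
  have htL : 1 / (2 * (L + 1)) * L ≤ 1 / 2 := by
    rw [one_div_mul_eq_div, div_le_div_iff₀ (by positivity) two_pos]
    linarith
  have hML : 240 * Real.pi * ‖ν‖ ≤ L := by rw [hL]; gcongr; norm_num
  have htM : 1 / (2 * (L + 1)) * (240 * Real.pi * ‖ν‖) ≤ 1 / 2 :=
    (mul_le_mul_of_nonneg_left hML (by positivity)).trans htL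
  exact ⟨1 / (2 * (L + 1)), by positivity, htM,
    exists_continuous_fixedPoint_smul (by positivity) (fun v => norm_fixMap_le)
      (fun v w => norm_fixMap_sub_le) (by linarith) htL⟩

theorem nonempty_profileFamily_neg_one (ν : ℂ) : Nonempty (ProfileFamily ν (-1)) := by
  obtain ⟨t₀, ht₀, htM, v, hv, hfix⟩ := exists_continuous_eq_smul_fixMap ν
  have hv0 : v 0 = 0 := by rw [(hfix 0 (by simp [ht₀.le])).2, zero_smul]
  have hcos : cosAdd (v 0) = fun θ => (Real.cos θ : ℂ) := by
    funext θ
    simp [cosAdd, hv0]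
  refine ⟨{
    radius := t₀
    radius_pos := ht₀
    shift := 0
    u := fun t => cosAdd (v t)
    u' := fun t => cosAddDeriv ν t (v t)
    r := fun t => cubicCoeff (cosAdd (v t))
    cos_two_mul_shift := by simp
    sin_two_mul_shift := by simp
    continuous_u := continuous_uncurry_cosAdd hv
    continuous_u' := continuous_uncurry_cosAddDeriv hv
    continuous_r := continuous_cubicCoeff_cosAdd hv
    u_zero := fun θ => by rw [hcos, add_zero]
    u'_zero := fun θ => by simp [cosAddDeriv]
    r_zero := by rw [hcos, cubicCoeff_cos]
    solvesCubic := fun t ht => solvesCubic_cosAdd (hfix t ht).2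
    exists_polarForm := fun t ht => ?_
    exists_eq_zero := fun t _ =>
      ⟨_, (evenAntiperiodic_cosAdd (v t)).eq_zero_of_cos_eq_zero Real.cos_pi_div_two⟩
    exists_ne_zero := fun t _ => ?_ }⟩
  · have hsol := solvesCubic_cosAdd (hfix t ht).2
    refine exists_polarForm (evenAntiperiodic_cosAdd (v t)) (hsol.contDiff 3) fun θ => ?_
    rw [(hsol.hasDerivAt θ).deriv]
    refine (norm_cosAddDeriv_add_sin_le (hfix t ht).1 θ).trans (htM.trans' ?_)
    gcongr
  · by_contra! hzero
    have hcoeff := cosCoeff_cosAdd (v t)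
    rw [show cosAdd (v t) = fun _ => 0 from funext hzero, Nonresonant.zero.cosCoeff_eq_zero]
      at hcoeff
    exact zero_ne_one hcoeff

namespace SolvesCubic

variable {p q : ℂ} {u u' : ℝ → ℂ}

theorem comp_add_const (hu : SolvesCubic p q u u') (c : ℝ) :
    SolvesCubic p q (fun θ => u (θ + c)) fun θ => u' (θ + c) where
  hasDerivAt θ := (hu.hasDerivAt (θ + c)).comp_add_const θ c
  hasDerivAt_deriv θ := (hu.hasDerivAt_deriv (θ + c)).comp_add_const θ c

theorem comp_mul_left (hu : SolvesCubic p q u u') (k : ℝ) :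
    SolvesCubic (k ^ 2 * p) (k ^ 2 * q) (fun x => u (k * x)) fun x => k * u' (k * x) := by
  have hk x : HasDerivAt (fun y => k * y) k x := by simpa using (hasDerivAt_id x).const_mul k
  constructor <;> intro x
  · simpa only [Complex.real_smul] using! (hu.hasDerivAt (k * x)).scomp x (hk x)
  · refine (((hu.hasDerivAt_deriv (k * x)).scomp x (hk x)).const_mul (k : ℂ)).congr_deriv ?_
    rw [Complex.real_smul]
    ring

theorem const_mul {c : ℝ} (hu : SolvesCubic p (c ^ 2 * q) u u') :
    SolvesCubic p q (fun x => c * u x) fun x => c * u' x where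
  hasDerivAt x := (hu.hasDerivAt x).const_mul (c : ℂ)
  hasDerivAt_deriv x := by
    refine ((hu.hasDerivAt_deriv x).const_mul (c : ℂ)).congr_deriv ?_
    simp only [cub, norm_mul, Complex.norm_real, mul_pow, Real.norm_eq_abs, sq_abs,
      Complex.real_smul, Complex.ofReal_mul, Complex.ofReal_pow]
    ring

end SolvesCubic

namespace ProfileFamily

variable {ν : ℂ} {σ : ℝ} (F : ProfileFamily ν σ)

/-- The family shifted by a quarter of its period, which has the opposite parity. -/
def quarterShift : ProfileFamily ν (-σ) where
  radius := F.radius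
  radius_pos := F.radius_pos
  shift := F.shift + Real.pi / 2
  u := fun t θ => F.u t (θ + Real.pi / 2)
  u' := fun t θ => F.u' t (θ + Real.pi / 2)
  r := F.r
  cos_two_mul_shift := by
    rw [mul_add, mul_div_cancel₀ _ two_ne_zero, Real.cos_add_pi, F.cos_two_mul_shift]
  sin_two_mul_shift := by
    rw [mul_add, mul_div_cancel₀ _ two_ne_zero, Real.sin_add_pi, F.sin_two_mul_shift, neg_zero]
  continuous_u := F.continuous_u.comp (by fun_prop : Continuous fun p : ℝ × ℝ =>
    (p.1, p.2 + Real.pi / 2))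
  continuous_u' := F.continuous_u'.comp (by fun_prop : Continuous fun p : ℝ × ℝ =>
    (p.1, p.2 + Real.pi / 2))
  continuous_r := F.continuous_r
  u_zero θ := by rw [F.u_zero, add_assoc, add_comm (Real.pi / 2)]
  u'_zero θ := by rw [F.u'_zero, add_assoc, add_comm (Real.pi / 2)]
  r_zero := F.r_zero
  solvesCubic t ht := (F.solvesCubic t ht).comp_add_const _
  exists_polarForm t ht :=
    let ⟨_, _, h⟩ := F.exists_polarForm t ht
    ⟨_, _, h.shift⟩
  exists_eq_zero t ht :=
    let ⟨θ, h⟩ := F.exists_eq_zero t ht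
    ⟨θ - Real.pi / 2, by rwa [sub_add_cancel]⟩
  exists_ne_zero t ht :=
    let ⟨θ, h⟩ := F.exists_ne_zero t ht
    ⟨θ - Real.pi / 2, by rwa [sub_add_cancel]⟩

end ProfileFamily

theorem nonempty_profileFamily (ν : ℂ) {σ : ℝ} (hσ : σ = 1 ∨ σ = -1) :
    Nonempty (ProfileFamily ν σ) := by
  obtain ⟨F⟩ := nonempty_profileFamily_neg_one ν
  rcases hσ with rfl | rfl
  · exact ⟨neg_neg (1 : ℝ) ▸ F.quarterShift⟩
  · exact ⟨F⟩

/-- `(x + i y) / (1 + i α)`: the coefficients of the Ginzburg-Landau equation after division by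
`1 + i α`. A stationary solution of frequency `ω` solves `V'' = -p V + q |V|² V` with
`p = coeff α μ ω` and `q = coeff α 1 β`. -/
def coeff (α x y : ℝ) : ℂ := (x + Complex.I * y) / (1 + Complex.I * α)

section Coeff

variable (α x y : ℝ)

theorem one_add_I_mul_ne_zero : (1 + Complex.I * α : ℂ) ≠ 0 := fun h => by
  simpa using congrArg Complex.re h

theorem one_add_I_mul_mul_coeff : (1 + Complex.I * α) * coeff α x y = x + Complex.I * y :=
  mul_div_cancel₀ _ (one_add_I_mul_ne_zero α)

theorem coeff_re : (coeff α x y).re = (x + α * y) / (1 + α ^ 2) := by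
  have hnormSq : Complex.normSq (1 + Complex.I * α) = 1 + α ^ 2 := by
    simp [Complex.normSq_apply, sq]
  simp only [coeff, Complex.div_re, Complex.add_re, Complex.ofReal_re, Complex.mul_re,
    Complex.I_re, zero_mul, Complex.I_im, Complex.ofReal_im, mul_zero, sub_self, add_zero,
    Complex.one_re, mul_one, hnormSq, Complex.add_im, Complex.mul_im, one_mul, zero_add,
    Complex.one_im]
  ring

theorem coeff_im : (coeff α x y).im = (y - α * x) / (1 + α ^ 2) := by
  have hnormSq : Complex.normSq (1 + Complex.I * α) = 1 + α ^ 2 := by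
    simp [Complex.normSq_apply, sq]
  simp only [coeff, Complex.div_im, Complex.add_im, Complex.ofReal_im, Complex.mul_im,
    Complex.I_re, mul_zero, Complex.I_im, Complex.ofReal_re, one_mul, zero_add, Complex.add_re,
    Complex.one_re, Complex.mul_re, zero_mul, sub_self, add_zero, mul_one, hnormSq,
    Complex.one_im]
  ring

end Coeff

section Invariants

theorem normSq_mul_normSq (z w : ℂ) : Complex.normSq z * Complex.normSq w =
    (conj z * w).re ^ 2 + (conj z * w).im ^ 2 := by
  rw [← Complex.normSq_conj z, ← Complex.normSq_mul, Complex.normSq_apply, sq, sq]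

theorem conj_mul_cub (z : ℂ) : conj z * cub z = (Complex.normSq z ^ 2 : ℝ) := by
  rw [cub, mul_smul_comm, ← Complex.normSq_eq_conj_mul_self, Complex.normSq_eq_norm_sq,
    Complex.real_smul, ← Complex.ofReal_mul, ← sq]

variable {f : ℝ → ℂ} {f' : ℂ} {x : ℝ}

theorem hasDerivAt_re (h : HasDerivAt f f' x) : HasDerivAt (fun y => (f y).re) f'.re x :=
  Complex.reCLM.hasFDerivAt.comp_hasDerivAt x h

theorem hasDerivAt_im (h : HasDerivAt f f' x) : HasDerivAt (fun y => (f y).im) f'.im x :=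
  Complex.imCLM.hasFDerivAt.comp_hasDerivAt x h

theorem hasDerivAt_normSq (h : HasDerivAt f f' x) :
    HasDerivAt (fun y => Complex.normSq (f y)) (2 * (conj (f x) * f').re) x := by
  refine ((((hasDerivAt_re h).fun_mul (hasDerivAt_re h)).fun_add
    ((hasDerivAt_im h).fun_mul (hasDerivAt_im h))).congr_deriv ?_)
  simp only [Complex.mul_re, Complex.conj_re, Complex.conj_im]
  ring

variable {p q : ℂ} {B B' : ℝ → ℂ}

theorem SolvesCubic.hasDerivAt_normSq (h : SolvesCubic p q B B') (x : ℝ) :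
    HasDerivAt (fun y => Complex.normSq (B y)) (2 * (conj (B x) * B' x).re) x :=
  CGL.hasDerivAt_normSq (h.hasDerivAt x)

theorem SolvesCubic.hasDerivAt_conj_mul (h : SolvesCubic p q B B') (x : ℝ) :
    HasDerivAt (fun y => conj (B y) * B' y)
      (Complex.normSq (B' x) - p * Complex.normSq (B x) + q * (Complex.normSq (B x) ^ 2 : ℝ))
      x := by
  refine ((h.hasDerivAt x).star.fun_mul (h.hasDerivAt_deriv x)).congr_deriv ?_
  rw [← conj_mul_cub, Complex.normSq_eq_conj_mul_self, Complex.normSq_eq_conj_mul_self]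
  simp only [starRingEnd_apply]
  ring

theorem SolvesCubic.hasDerivAt_re_conj_mul (h : SolvesCubic p q B B') (x : ℝ) :
    HasDerivAt (fun y => (conj (B y) * B' y).re)
      (Complex.normSq (B' x) - p.re * Complex.normSq (B x)
        + q.re * Complex.normSq (B x) ^ 2) x := by
  simpa only [Complex.add_re, Complex.sub_re, Complex.re_mul_ofReal, Complex.ofReal_re] using
    hasDerivAt_re (h.hasDerivAt_conj_mul x)

theorem SolvesCubic.hasDerivAt_im_conj_mul (h : SolvesCubic p q B B') (x : ℝ) :
    HasDerivAt (fun y => (conj (B y) * B' y).im)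
      (-p.im * Complex.normSq (B x) + q.im * Complex.normSq (B x) ^ 2) x := by
  simpa only [Complex.add_im, Complex.sub_im, Complex.im_mul_ofReal, Complex.ofReal_im, zero_sub,
    neg_mul] using hasDerivAt_im (h.hasDerivAt_conj_mul x)

theorem SolvesCubic.hasDerivAt_normSq_deriv (h : SolvesCubic p q B B') (x : ℝ) :
    HasDerivAt (fun y => Complex.normSq (B' y))
      (2 * ((-p.re + q.re * Complex.normSq (B x)) * (conj (B x) * B' x).re
        + (-p.im + q.im * Complex.normSq (B x)) * (conj (B x) * B' x).im)) x := by
  refine (CGL.hasDerivAt_normSq (h.hasDerivAt_deriv x)).congr_deriv ?_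
  have hfactor : -p * B x + q * cub (B x) = (-p + q * Complex.normSq (B x)) * B x := by
    rw [cub, Complex.normSq_eq_norm_sq, Complex.real_smul]
    ring
  rw [hfactor, mul_left_comm]
  simp only [Complex.mul_re, Complex.mul_im, Complex.add_re, Complex.add_im, Complex.neg_re,
    Complex.neg_im, Complex.ofReal_re, Complex.ofReal_im, Complex.conj_re, Complex.conj_im]
  ring

end Invariants

section Constants

variable {μ α β lam ω : ℝ}

theorem dC_ne_zero (hαβ : α ≠ β) : dC α β ≠ 0 := one_div_ne_zero (sub_ne_zero.2 hαβ.symm)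

theorem aC_ne_zero (hαβ : α ≠ β) : aC α β ≠ 0 := by
  have : β - α ≠ 0 := sub_ne_zero.2 hαβ.symm
  have : (0 : ℝ) < 1 + α ^ 2 := by positivity
  unfold aC
  positivity

theorem IsLambda.ne_zero (hlam : IsLambda α β lam) (hαβ : α ≠ β) : lam ≠ 0 := by
  rintro rfl
  simp [IsLambda, aC_ne_zero hαβ, dC_ne_zero hαβ] at hlam

theorem IsLambda.sq_eq (hlam : IsLambda α β lam) (hαβ : α ≠ β) :
    lam ^ 2 = aC α β * dC α β * (6 * lam * (coeff α 1 β).re + 2) := by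
  have hb : β - α ≠ 0 := sub_ne_zero.2 hαβ.symm
  have hA : (1 + α ^ 2 : ℝ) ≠ 0 := by positivity
  have hcC : cC α β = -6 * aC α β * dC α β * (coeff α 1 β).re := by
    rw [coeff_re]
    unfold cC aC dC
    field_simp
    ring
  rw [IsLambda, hcC] at hlam
  linear_combination hlam

theorem one_add_sq_eq (hαβ : α ≠ β) : 1 + α ^ 2 = 4 * (coeff α 1 β).im * aC α β := by
  have hb : β - α ≠ 0 := sub_ne_zero.2 hαβ.symm
  have hA : (1 + α ^ 2 : ℝ) ≠ 0 := by positivity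
  rw [coeff_im, mul_one, aC]
  field_simp

theorem one_add_sq_mul_coeff_im_mul_dC (hαβ : α ≠ β) :
    (1 + α ^ 2) * (coeff α 1 β).im * dC α β = 1 := by
  have hb : β - α ≠ 0 := sub_ne_zero.2 hαβ.symm
  have hA : (1 + α ^ 2 : ℝ) ≠ 0 := by positivity
  rw [coeff_im, mul_one, dC]
  field_simp

theorem eTilde_eq (hαβ : α ≠ β) : eTilde μ α β lam ω =
    4 * lam * (coeff α μ ω).re - 6 * lam * (coeff α 1 β).re * eC μ α β ω := by
  have hb : β - α ≠ 0 := sub_ne_zero.2 hαβ.symm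
  have hA : (1 + α ^ 2 : ℝ) ≠ 0 := by positivity
  rw [coeff_re, coeff_re]
  unfold eTilde bC aC eC
  field_simp
  ring

theorem coeff_im_eq (hαβ : α ≠ β) : (coeff α μ ω).im = eC μ α β ω * (coeff α 1 β).im := by
  have hb : β - α ≠ 0 := sub_ne_zero.2 hαβ.symm
  rw [coeff_im, coeff_im, eC]
  field_simp

end Constants

/-- The phase-space point, rescaled by `ε`, of a stationary solution `√(ε D) B` with `B = z` and
`B' = w`, where `e = ε η`. Its coordinates are read off from `R² = e + d P`, `Q = P'`,
`(1 + α²) G = (a / lam) Ñ - lam Q` and the last equation of the 4-D system; the formula keeps its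
meaning for `ε D ≤ 0`. -/
def orbitPoint (μ α β lam ω ε D η : ℝ) (z w : ℂ) : Fin 4 → ℝ :=
  ![lam * (2 * D * (Complex.normSq w - (coeff α μ ω).re * Complex.normSq z
        + ε * D * (coeff α 1 β).re * Complex.normSq z ^ 2) / dC α β)
      + eTilde μ α β lam ω * ((D * Complex.normSq z - η) / dC α β)
      + ε * dC α β * ((D * Complex.normSq z - η) / dC α β) ^ 2,
    lam / aC α β * ((1 + α ^ 2) * D * (conj z * w).im
      + lam * (2 * D * (conj z * w).re / dC α β)),
    (D * Complex.normSq z - η) / dC α β,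
    2 * D * (conj z * w).re / dC α β]

section OrbitPoint

variable {μ α β lam ω ε D η : ℝ}

theorem orbitPoint_one (z w : ℂ) : orbitPoint μ α β lam ω ε D η z w 1 =
    lam / aC α β * ((1 + α ^ 2) * D * (conj z * w).im
      + lam * (2 * D * (conj z * w).re / dC α β)) := rfl

theorem orbitPoint_two (z w : ℂ) : orbitPoint μ α β lam ω ε D η z w 2 =
    (D * Complex.normSq z - η) / dC α β := rfl

theorem orbitPoint_three (z w : ℂ) : orbitPoint μ α β lam ω ε D η z w 3 =
    2 * D * (conj z * w).re / dC α β := rfl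

theorem dC_mul_orbitPoint_two (hαβ : α ≠ β) (z w : ℂ) :
    dC α β * orbitPoint μ α β lam ω ε D η z w 2 = D * Complex.normSq z - η := by
  rw [orbitPoint_two, mul_div_cancel₀ _ (dC_ne_zero hαβ)]

theorem orbitPoint_zero_sub (z w : ℂ) :
    orbitPoint μ α β lam ω ε D η z w 0
      - ε * dC α β * orbitPoint μ α β lam ω ε D η z w 2 ^ 2
      - eTilde μ α β lam ω * orbitPoint μ α β lam ω ε D η z w 2 =
    lam * (2 * D * (Complex.normSq w - (coeff α μ ω).re * Complex.normSq z
      + ε * D * (coeff α 1 β).re * Complex.normSq z ^ 2) / dC α β) := by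
  simp only [orbitPoint, Matrix.cons_val]
  ring

theorem orbitPoint_one_sub (hαβ : α ≠ β) (hlam : IsLambda α β lam) (z w : ℂ) :
    aC α β / lam * orbitPoint μ α β lam ω ε D η z w 1
      - lam * orbitPoint μ α β lam ω ε D η z w 3 = (1 + α ^ 2) * D * (conj z * w).im := by
  have ha := aC_ne_zero hαβ
  have hl := hlam.ne_zero hαβ
  have hd := dC_ne_zero hαβ
  simp only [orbitPoint, Matrix.cons_val]
  field_simp
  ring

theorem orbitPoint_neg_right (z w : ℂ) :
    orbitPoint μ α β lam ω ε D η z (-w) =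
      ![orbitPoint μ α β lam ω ε D η z w 0, -orbitPoint μ α β lam ω ε D η z w 1,
        orbitPoint μ α β lam ω ε D η z w 2, -orbitPoint μ α β lam ω ε D η z w 3] := by
  ext i
  fin_cases i <;>
    simp only [orbitPoint, mul_neg, Complex.neg_re, Complex.neg_im, Complex.normSq_neg,
      Matrix.cons_val, Fin.reduceFinMk, Fin.zero_eta, Fin.mk_one] <;> ring

theorem orbitPoint_neg_neg (z w : ℂ) :
    orbitPoint μ α β lam ω ε D η (-z) (-w) = orbitPoint μ α β lam ω ε D η z w := by
  simp only [orbitPoint, map_neg, neg_mul_neg, Complex.normSq_neg]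

theorem continuous_orbitPoint {Y : Type*} [TopologicalSpace Y] {ω ε D η : Y → ℝ} {z w : Y → ℂ}
    (hω : Continuous ω) (hε : Continuous ε) (hD : Continuous D) (hη : Continuous η)
    (hz : Continuous z) (hw : Continuous w) :
    Continuous fun y => orbitPoint μ α β lam (ω y) (ε y) (D y) (η y) (z y) (w y) := by
  have : Continuous fun y => Complex.normSq (z y) := Complex.continuous_normSq.comp hz
  have : Continuous fun y => Complex.normSq (w y) := Complex.continuous_normSq.comp hw
  have hzw : Continuous fun y => conj (z y) * w y := (Complex.continuous_conj.comp hz).mul hw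
  have : Continuous fun y => (conj (z y) * w y).re := Complex.continuous_re.comp hzw
  have : Continuous fun y => (conj (z y) * w y).im := Complex.continuous_im.comp hzw
  refine continuous_pi fun i => ?_
  fin_cases i <;>
    simp only [orbitPoint, eTilde, bC, coeff_re, div_eq_mul_inv, Matrix.cons_val, Fin.reduceFinMk,
      Fin.zero_eta, Fin.mk_one] <;> fun_prop

theorem consistent_smul_orbitPoint (hαβ : α ≠ β) (hlam : IsLambda α β lam)
    (he : eC μ α β ω = ε * η) (z w : ℂ) :
    Consistent μ α β lam ω (ε • orbitPoint μ α β lam ω ε D η z w) := by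
  have hl := hlam.ne_zero hαβ
  have hd := dC_ne_zero hαβ
  have hP := dC_mul_orbitPoint_two (μ := μ) (lam := lam) (ω := ω) (ε := ε) (D := D) (η := η)
    hαβ z w
  have hM := orbitPoint_zero_sub (μ := μ) (α := α) (β := β) (lam := lam) (ω := ω) (ε := ε) (D := D)
    (η := η) z w
  have hN := orbitPoint_one_sub (μ := μ) (ω := ω) (ε := ε) (D := D) (η := η) hαβ hlam z w
  have hQ := orbitPoint_three (μ := μ) (α := α) (β := β) (lam := lam) (ω := ω) (ε := ε) (D := D)
    (η := η) z w
  have hK := normSq_mul_normSq z w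
  have hA : (1 + α ^ 2 : ℝ) ≠ 0 := by positivity
  rw [coeff_re, coeff_re] at hM
  generalize orbitPoint μ α β lam ω ε D η z w = X at *
  have hamp : dC α β * (ε * X 2) + ε * η = ε * D * Complex.normSq z := by linear_combination ε * hP
  have hacc : ε * X 0 - dC α β * (ε * X 2) ^ 2 - eTilde μ α β lam ω * (ε * X 2) =
    ε * (lam * (2 * D * (Complex.normSq w - (μ + α * ω) / (1 + α ^ 2) * Complex.normSq z
      + ε * D * ((1 + α * β) / (1 + α ^ 2)) * Complex.normSq z ^ 2) / dC α β)) := by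
    linear_combination ε * hM
  have hmom : aC α β / lam * (ε * X 1) - lam * (ε * X 3) =
      ε * ((1 + α ^ 2) * D * (conj z * w).im) := by linear_combination ε * hN
  simp only [Consistent, bigM, Pi.smul_apply, smul_eq_mul]
  rw [he, hamp, hacc, hmom, hQ]
  field_simp
  linear_combination 4 * (1 + α ^ 2) * ε ^ 2 * D ^ 2 * hK

end OrbitPoint

theorem mulVec_linMatrix_add_smul_quadPart (μ α β lam ω ε k₁ k₂ : ℝ) (X : Fin 4 → ℝ) :
    (linMatrix μ α β lam ω k₁).mulVec X + ε • quadPart α β lam k₂ X =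
      ![ε * (X 1 * X 2), lam / aC α β * X 0 + (k₁ + ε * k₂) * X 2, X 3,
        1 / lam * (X 0 - ε * dC α β * X 2 ^ 2 - eTilde μ α β lam ω * X 2)] := by
  ext i
  fin_cases i <;>
    simp [linMatrix, quadPart, dotProduct, Fin.sum_univ_four] <;> ring

theorem field4_smul (μ α β lam ω ε k₁ k₂ : ℝ) (X : Fin 4 → ℝ) :
    field4 μ α β lam ω (k₁ + ε * k₂) (ε • X) =
      ε • ((linMatrix μ α β lam ω k₁).mulVec X + ε • quadPart α β lam k₂ X) := by
  rw [mulVec_linMatrix_add_smul_quadPart]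
  ext i
  fin_cases i <;>
    simp only [field4, Pi.smul_apply, smul_eq_mul, Matrix.cons_val, Fin.reduceFinMk, Fin.zero_eta,
      Fin.mk_one] <;> ring

section OrbitDerivative

variable {μ α β lam ω ε D η : ℝ} {B B' : ℝ → ℂ}

theorem hasDerivAt_orbitPoint_two {p q : ℂ} (hB : SolvesCubic p q B B') (x : ℝ) :
    HasDerivAt (fun y => orbitPoint μ α β lam ω ε D η (B y) (B' y) 2)
      (orbitPoint μ α β lam ω ε D η (B x) (B' x) 3) x := by
  refine ((((hB.hasDerivAt_normSq x).const_mul D).sub_const η).div_const (dC α β)).congr_deriv ?_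
  rw [orbitPoint_three]
  ring

theorem hasDerivAt_orbitPoint_three
    (hB : SolvesCubic (coeff α μ ω) ((ε * D : ℝ) * coeff α 1 β) B B') (x : ℝ) :
    HasDerivAt (fun y => orbitPoint μ α β lam ω ε D η (B y) (B' y) 3)
      (2 * D * (Complex.normSq (B' x) - (coeff α μ ω).re * Complex.normSq (B x)
        + ε * D * (coeff α 1 β).re * Complex.normSq (B x) ^ 2) / dC α β) x := by
  refine (((hB.hasDerivAt_re_conj_mul x).const_mul (2 * D)).div_const (dC α β)).congr_deriv ?_
  rw [Complex.re_ofReal_mul]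

theorem hasDerivAt_orbitPoint_one (hαβ : α ≠ β) (he : eC μ α β ω = ε * η)
    (hB : SolvesCubic (coeff α μ ω) ((ε * D : ℝ) * coeff α 1 β) B B') (x : ℝ) :
    HasDerivAt (fun y => orbitPoint μ α β lam ω ε D η (B y) (B' y) 1)
      (lam / aC α β * (orbitPoint μ α β lam ω ε D η (B x) (B' x) 0
        - (eTilde μ α β lam ω - ε * η) * orbitPoint μ α β lam ω ε D η (B x) (B' x) 2)) x := by
  have hQ := hasDerivAt_orbitPoint_three (lam := lam) (η := η) hB x
  refine ((((hB.hasDerivAt_im_conj_mul x).const_mul ((1 + α ^ 2) * D)).fun_add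
    (hQ.const_mul lam)).const_mul (lam / aC α β)).congr_deriv ?_
  have hM := orbitPoint_zero_sub (μ := μ) (α := α) (β := β) (lam := lam) (ω := ω) (ε := ε) (D := D)
    (η := η) (B x) (B' x)
  have hP := dC_mul_orbitPoint_two (μ := μ) (lam := lam) (ω := ω) (ε := ε) (D := D) (η := η)
    hαβ (B x) (B' x)
  rw [Complex.im_ofReal_mul, coeff_im_eq hαβ, he]
  have hdual := one_add_sq_mul_coeff_im_mul_dC hαβ
  linear_combination lam / aC α β * (-hM
    - (ε * orbitPoint μ α β lam ω ε D η (B x) (B' x) 2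
      + (1 + α ^ 2) * D * ε * Complex.normSq (B x) * (coeff α 1 β).im) * hP
    + ε * D * Complex.normSq (B x) * orbitPoint μ α β lam ω ε D η (B x) (B' x) 2 * hdual)

theorem hasDerivAt_orbitPoint_zero (hαβ : α ≠ β) (hlam : IsLambda α β lam)
    (he : eC μ α β ω = ε * η)
    (hB : SolvesCubic (coeff α μ ω) ((ε * D : ℝ) * coeff α 1 β) B B') (x : ℝ) :
    HasDerivAt (fun y => orbitPoint μ α β lam ω ε D η (B y) (B' y) 0)
      (ε * (orbitPoint μ α β lam ω ε D η (B x) (B' x) 1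
        * orbitPoint μ α β lam ω ε D η (B x) (B' x) 2)) x := by
  have ha := aC_ne_zero hαβ
  have hd := dC_ne_zero hαβ
  have hn := hB.hasDerivAt_normSq x
  have hP := hasDerivAt_orbitPoint_two (μ := μ) (α := α) (β := β) (lam := lam) (ω := ω) (ε := ε)
    (D := D) (η := η) hB x
  refine (((((((hB.hasDerivAt_normSq_deriv x).fun_sub (hn.const_mul (coeff α μ ω).re)).fun_add
    ((hn.fun_pow 2).const_mul (ε * D * (coeff α 1 β).re))).const_mul (2 * D)).div_const
      (dC α β)).const_mul lam |>.fun_add (hP.const_mul (eTilde μ α β lam ω))).fun_add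
      ((hP.fun_pow 2).const_mul (ε * dC α β))).congr_deriv ?_
  have hlin : lam / aC α β * (1 + α ^ 2) = 4 * lam * (coeff α 1 β).im := by
    rw [one_add_sq_eq hαβ]
    field_simp
  have hquad : lam / aC α β * lam = dC α β * (6 * lam * (coeff α 1 β).re + 2) := by
    field_simp
    linear_combination hlam.sq_eq hαβ
  rw [Complex.re_ofReal_mul, Complex.im_ofReal_mul, coeff_im_eq hαβ, eTilde_eq hαβ, he]
  have hPz := dC_mul_orbitPoint_two (μ := μ) (lam := lam) (ω := ω) (ε := ε) (D := D) (η := η)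
    hαβ (B x) (B' x)
  have hdd : dC α β * (dC α β)⁻¹ = 1 := mul_inv_cancel₀ hd
  rw [orbitPoint_three, orbitPoint_one]
  generalize orbitPoint μ α β lam ω ε D η (B x) (B' x) 2 = P at *
  generalize (conj (B x) * B' x).re = j
  generalize (conj (B x) * B' x).im = m
  linear_combination
    -(6 * lam * ε * (coeff α 1 β).re * (2 * D * j / dC α β)
      + 4 * lam * D * ε * (coeff α 1 β).im * m / dC α β) * hPz
    - ε * P * D * m * hlin - ε * P * (2 * D * j / dC α β) * hquad
    + 4 * lam * D * ε * (coeff α 1 β).im * m * P * hdd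

theorem hasDerivAt_orbitPoint (hαβ : α ≠ β) (hlam : IsLambda α β lam) (he : eC μ α β ω = ε * η)
    (hB : SolvesCubic (coeff α μ ω) ((ε * D : ℝ) * coeff α 1 β) B B') (x : ℝ) :
    HasDerivAt (fun y => orbitPoint μ α β lam ω ε D η (B y) (B' y))
      ((linMatrix μ α β lam ω (-(lam * eTilde μ α β lam ω / aC α β))).mulVec
        (orbitPoint μ α β lam ω ε D η (B x) (B' x))
        + ε • quadPart α β lam (lam / aC α β * η)
          (orbitPoint μ α β lam ω ε D η (B x) (B' x))) x := by
  rw [mulVec_linMatrix_add_smul_quadPart, orbitPoint_zero_sub,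
    one_div_mul_eq_div,
    mul_div_cancel_left₀ _ (hlam.ne_zero hαβ), hasDerivAt_pi]
  intro i
  fin_cases i
  · exact hasDerivAt_orbitPoint_zero hαβ hlam he hB x
  · refine (hasDerivAt_orbitPoint_one hαβ he hB x).congr_deriv ?_
    simp only [Matrix.cons_val, Fin.mk_one]
    ring
  · exact hasDerivAt_orbitPoint_two hB x
  · exact hasDerivAt_orbitPoint_three hB x

end OrbitDerivative

theorem ker_toLin'_linMatrix {μ α β lam ω : ℝ} (hlam : lam ≠ 0) :
    LinearMap.ker (Matrix.toLin' (linMatrix μ α β lam ω (-(lam * eTilde μ α β lam ω / aC α β)))) =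
      LinearMap.range (Matrix.toLin' !![0, eTilde μ α β lam ω; 1, 0; 0, 1; 0, 0]) := by
  ext v
  rw [LinearMap.mem_ker, LinearMap.mem_range]
  constructor
  · intro hv
    have hw : v 3 = 0 := by
      simpa [dotProduct, Fin.sum_univ_four, linMatrix] using congrFun hv 2
    have hx : v 0 = eTilde μ α β lam ω * v 2 := by
      have hrow := congrFun hv 3
      simp only [linMatrix, Matrix.toLin'_apply, Matrix.mulVec, dotProduct, Fin.sum_univ_four,
        Matrix.of_apply, Matrix.cons_val, Pi.zero_apply] at hrow
      field_simp at hrow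
      linarith
    refine ⟨![v 1, v 2], ?_⟩
    ext i
    fin_cases i <;> simp [hx, hw, mul_comm]
  · rintro ⟨w, rfl⟩
    ext i
    fin_cases i <;> simp [dotProduct, Fin.sum_univ_two, linMatrix] <;> ring

theorem finrank_ker_linMatrix {μ α β lam ω : ℝ} (hlam : lam ≠ 0) :
    Module.finrank ℝ (LinearMap.ker (Matrix.toLin'
      (linMatrix μ α β lam ω (-(lam * eTilde μ α β lam ω / aC α β))))) = 2 := by
  rw [ker_toLin'_linMatrix hlam, LinearMap.finrank_range_of_inj, Module.finrank_fin_fun]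
  refine (injective_iff_map_eq_zero _).2 fun v hv => ?_
  have hv0 : v 0 = 0 := by simpa [dotProduct, Fin.sum_univ_two] using congrFun hv 1
  have hv1 : v 1 = 0 := by simpa [dotProduct, Fin.sum_univ_two] using congrFun hv 2
  ext i
  fin_cases i
  · exact hv0
  · exact hv1

section Stationary

variable {μ α β ω : ℝ} {p q : ℂ} {V V' : ℝ → ℂ}

theorem SolvesCubic.iteratedDeriv_two (hV : SolvesCubic p q V V') (x : ℝ) :
    iteratedDeriv 2 V x = -p * V x + q * cub (V x) := by
  rw [iteratedDeriv_succ, iteratedDeriv_one, funext fun y => (hV.hasDerivAt y).deriv,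
    (hV.hasDerivAt_deriv x).deriv]

theorem SolvesCubic.solvesCGL (hV : SolvesCubic (coeff α μ ω) (coeff α 1 β) V V') :
    SolvesCGL μ α β fun x t => V x * Complex.exp (-(Complex.I * ω * t)) := by
  have hphase : ∀ t : ℝ, HasDerivAt (fun s : ℝ => Complex.exp (-(Complex.I * ω * s)))
      (Complex.exp (-(Complex.I * ω * t)) * -(Complex.I * ω)) t := fun t => by
    simpa using ((hasDerivAt_id t).ofReal_comp.const_mul (Complex.I * ω)).fun_neg.cexp
  have hnorm : ∀ x t : ℝ, ‖V x * Complex.exp (-(Complex.I * ω * t))‖ = ‖V x‖ := fun x t => by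
    simp [Complex.norm_exp]
  refine ⟨fun t => (hV.contDiff 2).mul contDiff_const, fun x => contDiff_const.mul ?_,
    fun x t => ?_⟩
  · exact (contDiff_const.mul Complex.ofRealCLM.contDiff).neg.cexp
  · rw [((hphase t).const_mul (V x)).deriv, hnorm, iteratedDeriv_mul_const_field,
      hV.iteratedDeriv_two, cub, Complex.real_smul, Complex.ofReal_pow]
    have hp := one_add_I_mul_mul_coeff α μ ω
    have hq := one_add_I_mul_mul_coeff α 1 β
    rw [Complex.ofReal_one] at hq
    linear_combination V x * Complex.exp (-(Complex.I * ω * t)) * hp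
      - ‖V x‖ ^ 2 * V x * Complex.exp (-(Complex.I * ω * t)) * hq

theorem hasDerivAt_mul_exp_I {f : ℝ → ℂ} {f' : ℂ} {ψ : ℝ → ℝ} {ψ' x : ℝ}
    (hf : HasDerivAt f f' x) (hψ : HasDerivAt ψ ψ' x) :
    HasDerivAt (fun y => f y * Complex.exp (Complex.I * ψ y))
      ((f' + Complex.I * ψ' * f x) * Complex.exp (Complex.I * ψ x)) x := by
  refine (hf.fun_mul (hψ.ofReal_comp.const_mul Complex.I).cexp).congr_deriv ?_
  ring

theorem hasDerivAt_deriv_deriv {f : ℝ → ℝ} (hf : ContDiff ℝ 2 f) (x : ℝ) :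
    HasDerivAt (deriv f) (deriv (deriv f) x) x :=
  (((contDiff_succ_iff_deriv (n := 1)).1 (by exact_mod_cast hf)).2.2.differentiable
    one_ne_zero x).hasDerivAt

namespace PolarForm

variable {σ T : ℝ} {R φ : ℝ → ℝ}

theorem hasDerivAt_amplitude (h : PolarForm σ T V R φ) (x : ℝ) :
    HasDerivAt R (deriv R x) x :=
  (h.contDiff_amplitude.differentiable two_ne_zero x).hasDerivAt

theorem hasDerivAt_phase (h : PolarForm σ T V R φ) (x : ℝ) : HasDerivAt φ (deriv φ x) x :=
  (h.contDiff_phase.differentiable two_ne_zero x).hasDerivAt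

theorem deriv_eq (h : PolarForm σ T V R φ) (hV : ∀ x, HasDerivAt V (V' x) x) (x : ℝ) :
    V' x = ((deriv R x : ℝ) + Complex.I * deriv φ x * R x) * Complex.exp (Complex.I * φ x) := by
  refine (hV x).unique ?_
  rw [funext h.eq_polar]
  exact hasDerivAt_mul_exp_I (h.hasDerivAt_amplitude x).ofReal_comp (h.hasDerivAt_phase x)

theorem angMom_eq (h : PolarForm σ T V R φ) (hV : ∀ x, HasDerivAt V (V' x) x) (x : ℝ) :
    angMom R φ x = (conj (V x) * V' x).im := by
  have hunit : conj (Complex.exp (Complex.I * φ x)) * Complex.exp (Complex.I * φ x) = 1 := by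
    rw [← Complex.normSq_eq_conj_mul_self, Complex.normSq_eq_norm_sq]
    simp [Complex.norm_exp]
  have hprod : conj (V x) * V' x = (R x * deriv R x : ℝ) + (angMom R φ x : ℝ) * Complex.I := by
    rw [h.deriv_eq hV, h.eq_polar, map_mul, Complex.conj_ofReal, angMom]
    push_cast
    linear_combination R x * ((deriv R x : ℝ) + Complex.I * (deriv φ x : ℝ) * R x) * hunit
  rw [hprod, Complex.add_im, Complex.ofReal_im, Complex.im_ofReal_mul, Complex.I_im]
  ring

theorem polar_equation (h : PolarForm σ T V R φ) (hV : SolvesCubic p q V V') (x : ℝ) :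
    ((deriv (deriv R) x - R x * deriv φ x ^ 2 : ℝ) : ℂ)
      + (2 * deriv R x * deriv φ x + R x * deriv (deriv φ) x : ℝ) * Complex.I =
    -p * R x + q * (R x ^ 3 : ℝ) := by
  have hR := hasDerivAt_deriv_deriv h.contDiff_amplitude x
  have hφ := hasDerivAt_deriv_deriv h.contDiff_phase x
  have hpolar := hasDerivAt_mul_exp_I (hR.ofReal_comp.fun_add
    ((hφ.ofReal_comp.const_mul Complex.I).fun_mul (h.hasDerivAt_amplitude x).ofReal_comp))
    (h.hasDerivAt_phase x)
  have hV' := hV.hasDerivAt_deriv x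
  rw [funext (h.deriv_eq hV.hasDerivAt), cub, ← Complex.normSq_eq_norm_sq, h.normSq_eq,
    h.eq_polar, Complex.real_smul] at hV'
  refine mul_right_cancel₀ (Complex.exp_ne_zero (Complex.I * φ x)) ?_
  push_cast at hV' ⊢
  linear_combination hpolar.unique hV'
    - R x * (deriv φ x : ℝ) ^ 2 * Complex.exp (Complex.I * φ x) * Complex.I_sq

theorem solvesStationary (h : PolarForm σ T V R φ)
    (hV : SolvesCubic (coeff α μ ω) (coeff α 1 β) V V') : SolvesStationary μ α β ω R φ := by
  have hpolar := h.polar_equation hV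
  have hA : (1 + α ^ 2 : ℝ) ≠ 0 := by positivity
  refine ⟨h.contDiff_amplitude, h.contDiff_phase, fun x => ?_, fun x => ?_⟩
  · have him := congrArg Complex.im (hpolar x)
    rw [← neg_mul_eq_neg_mul] at him
    simp only [Complex.add_im, Complex.neg_im, Complex.im_mul_ofReal, Complex.ofReal_im,
      Complex.im_ofReal_mul, Complex.I_im, coeff_im] at him
    unfold angMom
    rw [((hasDerivAt_deriv_deriv h.contDiff_phase x).fun_mul
      ((h.hasDerivAt_amplitude x).fun_pow 2)).deriv]
    field_simp at him
    push_cast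
    linear_combination R x * him
  · have hre := congrArg Complex.re (hpolar x)
    rw [← neg_mul_eq_neg_mul] at hre
    simp only [Complex.add_re, Complex.neg_re, Complex.re_mul_ofReal, Complex.ofReal_re,
      Complex.re_ofReal_mul, Complex.I_re, coeff_re] at hre
    rw [iteratedDeriv_succ, iteratedDeriv_one, angMom]
    field_simp at hre
    linear_combination -R x ^ 3 * hre

end PolarForm

end Stationary

theorem SolvesCubic.sqrt_mul {p q : ℂ} {B B' : ℝ → ℂ} {δ : ℝ} (hδ : 0 ≤ δ)
    (hB : SolvesCubic p (δ * q) B B') :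
    SolvesCubic p q (fun x => (√δ : ℝ) * B x) fun x => (√δ : ℝ) * B' x := by
  refine SolvesCubic.const_mul ?_
  rwa [← Complex.ofReal_pow, Real.sq_sqrt hδ]

namespace PolarForm

variable {σ T : ℝ} {B B' : ℝ → ℂ} {S ψ : ℝ → ℝ}

theorem deriv_neg (h : PolarForm σ T B S ψ) (hB : ∀ x, HasDerivAt B (B' x) x) (x : ℝ) :
    B' (-x) = σ * B' x := by
  have hderiv := deriv_comp_neg B x
  rw [funext h.apply_neg, deriv_const_mul_field, (hB _).deriv, (hB _).deriv] at hderiv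
  linear_combination hderiv

theorem antiperiodic_deriv (h : PolarForm σ T B S ψ) (hB : ∀ x, HasDerivAt B (B' x) x) :
    Function.Antiperiodic B' T := fun x => by
  have hderiv := deriv_comp_add_const B T x
  rw [funext h.antiperiodic, (hB _).deriv] at hderiv
  rw [← hderiv, ← (hB x).deriv]
  exact deriv.fun_neg

variable {μ α β lam ω ε D η : ℝ}

theorem isSymmetricOrbit (h : PolarForm σ T B S ψ) (hB : ∀ x, HasDerivAt B (B' x) x)
    (hσ : σ = 1 ∨ σ = -1) :
    IsSymmetricOrbit fun x => orbitPoint μ α β lam ω ε D η (B x) (B' x) := fun x => by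
  beta_reduce
  rw [h.apply_neg, h.deriv_neg hB, ← orbitPoint_neg_right]
  rcases hσ with rfl | rfl
  · rw [← orbitPoint_neg_neg]
    simp only [Complex.ofReal_one, neg_mul, one_mul, neg_neg]
  · simp only [Complex.ofReal_neg, Complex.ofReal_one, neg_neg, neg_mul, one_mul]

theorem periodic_orbitPoint (h : PolarForm σ T B S ψ) (hB : ∀ x, HasDerivAt B (B' x) x) :
    Function.Periodic (fun x => orbitPoint μ α β lam ω ε D η (B x) (B' x)) T := fun x => by
  beta_reduce
  rw [h.antiperiodic, h.antiperiodic_deriv hB, orbitPoint_neg_neg]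

theorem sq_sqrt_mul_amplitude_eq (h : PolarForm σ T B S ψ) (hαβ : α ≠ β)
    (he : eC μ α β ω = ε * η) (hδ : 0 ≤ ε * D) (w : ℂ) (x : ℝ) :
    (√(ε * D) * S x) ^ 2 =
      eC μ α β ω + dC α β * (ε * orbitPoint μ α β lam ω ε D η (B x) w 2) := by
  rw [mul_pow, Real.sq_sqrt hδ, ← h.normSq_eq, he]
  linear_combination -ε * dC_mul_orbitPoint_two (μ := μ) (lam := lam) (ω := ω) (ε := ε) (D := D)
    (η := η) hαβ (B x) w

theorem angMom_sqrt_mul_eq (h : PolarForm σ T B S ψ) (hB : ∀ x, HasDerivAt B (B' x) x)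
    (hαβ : α ≠ β) (hlam : IsLambda α β lam) (hδ : 0 ≤ ε * D) (x : ℝ) :
    angMom (fun y => √(ε * D) * S y) ψ x =
      (aC α β / lam * (ε * orbitPoint μ α β lam ω ε D η (B x) (B' x) 1)
        - lam * (ε * orbitPoint μ α β lam ω ε D η (B x) (B' x) 3)) / (1 + α ^ 2) := by
  have hA : (1 + α ^ 2 : ℝ) ≠ 0 := by positivity
  have hang : angMom (fun y => √(ε * D) * S y) ψ x = ε * D * angMom S ψ x := by
    rw [angMom, angMom, mul_pow, Real.sq_sqrt hδ]
    ring
  rw [hang, h.angMom_eq hB, eq_div_iff hA]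
  linear_combination -ε * orbitPoint_one_sub (μ := μ) (ω := ω) (ε := ε) (D := D) (η := η)
    hαβ hlam (B x) (B' x)

theorem solvesCGL (h : PolarForm σ T B S ψ)
    (hB : SolvesCubic (coeff α μ ω) (coeff α 1 β) B B') :
    SolvesCGL μ α β fun x t =>
      S x * Complex.exp (Complex.I * ψ x - Complex.I * ω * t) := by
  have hfactor : (fun (x t : ℝ) => (S x * Complex.exp (Complex.I * ψ x - Complex.I * ω * t) : ℂ)) =
      fun (x t : ℝ) => B x * Complex.exp (-(Complex.I * ω * t)) := by
    ext x t
    rw [h.eq_polar, sub_eq_add_neg, Complex.exp_add, mul_assoc Complex.I, mul_assoc (S x : ℂ)]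
  exact hfactor ▸ hB.solvesCGL

end PolarForm

namespace ProfileFamily

variable {α β σ : ℝ} (F : ProfileFamily (coeff α 1 β) σ) (μ κ lam ε : ℝ)

/-- `(1 + i β) r(t)` at `t = κ ε / μ`: the nonlinear correction to `μ + i ω`, whose real part
changes the angular frequency of the profile and whose imaginary part changes `ω`. -/
def freqShift : ℂ := (1 + Complex.I * β) * F.r (κ * ε / μ)

/-- The factor by which `(Ω / 2)²` falls short of `μ`. The truncation at `1 / 2`, inactive for small
`ε`, makes all parameters of the branch continuous on the whole line. -/
def detuning : ℝ := max (1 + κ * ε / μ * (F.freqShift μ κ ε).re) (1 / 2)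

/-- The angular frequency `Ω` of the orbit. -/
def angularFreq : ℝ := 2 * √(μ / F.detuning μ κ ε)

/-- The quotient `e / ε`, where `e` is the squared amplitude of the plane wave of frequency `ω`. -/
def slope : ℝ :=
  dC α β * κ * ((F.freqShift μ κ ε).im - α * (F.freqShift μ κ ε).re) / F.detuning μ κ ε

/-- The temporal frequency `ω`, determined by `e = ε * slope`. -/
def omega : ℝ := μ * α + ε * F.slope μ κ ε * (β - α)

/-- The coefficient `γ` in `Ω² = ẽ / lam + ε γ`. -/
def freqCorrection : ℝ :=
  -(4 * κ * (F.freqShift μ κ ε).re / F.detuning μ κ ε)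
    - (4 * α * (β - α) - 6 * (1 + α * β)) * F.slope μ κ ε / (1 + α ^ 2)

/-- The coefficient `k₂` in `k = k₁ + ε k₂`. -/
def couplingCorrection : ℝ := lam / aC α β * F.slope μ κ ε

/-- The wavenumber `q` of the plane waves of frequency `ω`. -/
def wavenumber : ℝ := √(μ - ε * F.slope μ κ ε)

/-- The profile `B` of the stationary solution `√(ε κ / detuning) B`. -/
def profile (x : ℝ) : ℂ := F.u (κ * ε / μ) (F.angularFreq μ κ ε / 2 * x)

/-- The derivative of `profile`. -/
def profileDeriv (x : ℝ) : ℂ :=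
  (F.angularFreq μ κ ε / 2 : ℝ) * F.u' (κ * ε / μ) (F.angularFreq μ κ ε / 2 * x)

/-- The rescaled orbit `X(ε, ·)` of the 4-D system. -/
def orbit (τ : ℝ) : Fin 4 → ℝ :=
  orbitPoint μ α β lam (F.omega μ κ ε) ε (κ / F.detuning μ κ ε) (F.slope μ κ ε)
    (F.profile μ κ ε τ) (F.profileDeriv μ κ ε τ)

theorem detuning_pos : 0 < F.detuning μ κ ε := lt_max_of_lt_right one_half_pos

theorem continuous_freqShift : Continuous (F.freqShift μ κ) :=
  continuous_const.mul (F.continuous_r.comp (by fun_prop))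

theorem continuous_re_freqShift : Continuous fun ε => (F.freqShift μ κ ε).re :=
  Complex.continuous_re.comp (F.continuous_freqShift μ κ)

theorem continuous_detuning : Continuous (F.detuning μ κ) := by
  have := F.continuous_re_freqShift μ κ
  unfold detuning
  fun_prop

theorem continuous_angularFreq : Continuous (F.angularFreq μ κ) :=
  continuous_const.mul (continuous_const.div (F.continuous_detuning μ κ)
    fun ε => (F.detuning_pos μ κ ε).ne').sqrt

theorem continuous_slope : Continuous (F.slope μ κ) := by
  have hre := F.continuous_re_freqShift μ κ
  have him := Complex.continuous_im.comp (F.continuous_freqShift μ κ)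
  exact (continuous_const.mul (him.sub (continuous_const.mul hre))).div
    (F.continuous_detuning μ κ) fun ε => (F.detuning_pos μ κ ε).ne'

theorem continuous_omega : Continuous (F.omega μ κ) := by
  have := F.continuous_slope μ κ
  unfold omega
  fun_prop

theorem continuous_eTilde_omega : Continuous fun ε => eTilde μ α β lam (F.omega μ κ ε) := by
  have := F.continuous_omega μ κ
  simp only [eTilde, bC, div_eq_mul_inv]
  fun_prop

theorem continuous_freqCorrection : Continuous (F.freqCorrection μ κ) := by
  have hslope := F.continuous_slope μ κ
  exact ((continuous_const.mul (F.continuous_re_freqShift μ κ)).div (F.continuous_detuning μ κ)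
    fun ε => (F.detuning_pos μ κ ε).ne').neg.sub (by fun_prop)

theorem continuous_couplingCorrection : Continuous (F.couplingCorrection μ κ lam) :=
  continuous_const.mul (F.continuous_slope μ κ)

theorem continuous_wavenumber : Continuous (F.wavenumber μ κ) := by
  have := F.continuous_slope μ κ
  unfold wavenumber
  fun_prop

theorem continuous_orbit : Continuous fun p : ℝ × ℝ => F.orbit μ κ lam p.1 p.2 := by
  have hΩ := F.continuous_angularFreq μ κ
  have hphase : Continuous fun p : ℝ × ℝ =>
      (κ * p.1 / μ, F.angularFreq μ κ p.1 / 2 * p.2) := by fun_prop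
  refine continuous_orbitPoint ((F.continuous_omega μ κ).comp continuous_fst) continuous_fst
    ((continuous_const.div (F.continuous_detuning μ κ)
      fun ε => (F.detuning_pos μ κ ε).ne').comp continuous_fst)
    ((F.continuous_slope μ κ).comp continuous_fst) (F.continuous_u.comp hphase)
    (Continuous.mul ?_ (F.continuous_u'.comp hphase))
  exact Complex.continuous_ofReal.comp ((hΩ.div_const 2).comp continuous_fst)

theorem freqShift_zero : F.freqShift μ κ 0 = (3 / 4 : ℝ) + (3 / 4 * β : ℝ) * Complex.I := by
  rw [freqShift, mul_zero, zero_div, F.r_zero]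
  push_cast
  ring

theorem re_freqShift_zero : (F.freqShift μ κ 0).re = 3 / 4 := by
  rw [freqShift_zero, Complex.add_re, Complex.ofReal_re, Complex.re_ofReal_mul, Complex.I_re]
  ring

theorem im_freqShift_zero : (F.freqShift μ κ 0).im = 3 / 4 * β := by
  rw [freqShift_zero, Complex.add_im, Complex.ofReal_im, Complex.im_ofReal_mul, Complex.I_im]
  ring

theorem detuning_zero : F.detuning μ κ 0 = 1 := by
  rw [detuning, mul_zero, zero_div, zero_mul, add_zero, max_eq_left one_half_lt_one.le]

theorem angularFreq_zero : F.angularFreq μ κ 0 = 2 * √μ := by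
  rw [angularFreq, detuning_zero, div_one]

theorem slope_zero (hαβ : α ≠ β) : F.slope μ κ 0 = 3 / 4 * κ := by
  have hb : β - α ≠ 0 := sub_ne_zero.2 hαβ.symm
  rw [slope, re_freqShift_zero, im_freqShift_zero, detuning_zero, dC]
  field_simp

theorem omega_zero : F.omega μ κ 0 = μ * α := by
  rw [omega, zero_mul, zero_mul, add_zero]

theorem freqCorrection_zero (hαβ : α ≠ β) (a₂ : ℝ) :
    F.freqCorrection μ (-(4 * dC α β * a₂)) 0 = cC α β / aC α β * a₂ := by
  have hb : β - α ≠ 0 := sub_ne_zero.2 hαβ.symm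
  have hA : (1 + α ^ 2 : ℝ) ≠ 0 := by positivity
  rw [freqCorrection, F.slope_zero _ _ hαβ, re_freqShift_zero, detuning_zero, cC, aC, dC]
  field_simp
  ring

theorem couplingCorrection_zero (hαβ : α ≠ β) (a₂ : ℝ) :
    F.couplingCorrection μ (-(4 * dC α β * a₂)) lam 0 = -(3 * lam / aC α β * dC α β * a₂) := by
  rw [couplingCorrection, F.slope_zero _ _ hαβ]
  ring

theorem wavenumber_zero : F.wavenumber μ κ 0 = √μ := by
  rw [wavenumber, zero_mul, sub_zero]

theorem eC_omega (hαβ : α ≠ β) : eC μ α β (F.omega μ κ ε) = ε * F.slope μ κ ε := by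
  rw [eC, omega, add_sub_cancel_left, mul_div_cancel_right₀ _ (sub_ne_zero.2 hαβ.symm)]

theorem profile_zero (τ : ℝ) : F.profile μ κ 0 τ = (Real.cos (√μ * τ + F.shift) : ℝ) := by
  rw [profile, mul_zero, zero_div, F.u_zero, angularFreq_zero, mul_div_cancel_left₀ _ two_ne_zero]

theorem profileDeriv_zero (τ : ℝ) :
    F.profileDeriv μ κ 0 τ = (-(√μ * Real.sin (√μ * τ + F.shift)) : ℝ) := by
  rw [profileDeriv, mul_zero, zero_div, F.u'_zero, angularFreq_zero,
    mul_div_cancel_left₀ _ two_ne_zero, Complex.ofReal_neg, Complex.ofReal_mul, mul_neg]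

theorem mul_cos_two_mul (θ : ℝ) :
    σ * Real.cos (2 * θ) = 1 - 2 * Real.cos (θ + F.shift) ^ 2 := by
  have hadd : Real.cos (2 * (θ + F.shift)) = -(σ * Real.cos (2 * θ)) := by
    rw [mul_add, Real.cos_add, F.cos_two_mul_shift, F.sin_two_mul_shift]
    ring
  rw [Real.cos_two_mul] at hadd
  linarith

theorem mul_sin_two_mul (θ : ℝ) :
    σ * Real.sin (2 * θ) = -(2 * Real.sin (θ + F.shift) * Real.cos (θ + F.shift)) := by
  rw [← Real.sin_two_mul, mul_add, Real.sin_add, F.cos_two_mul_shift, F.sin_two_mul_shift]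
  ring

variable {μ}

theorem angularFreq_pos (hμ : 0 < μ) : 0 < F.angularFreq μ κ ε :=
  mul_pos two_pos (Real.sqrt_pos.2 (div_pos hμ (F.detuning_pos μ κ ε)))

theorem sq_half_angularFreq (hμ : 0 < μ) :
    (F.angularFreq μ κ ε / 2) ^ 2 = μ / F.detuning μ κ ε := by
  rw [angularFreq, mul_div_cancel_left₀ _ two_ne_zero,
    Real.sq_sqrt (div_pos hμ (F.detuning_pos μ κ ε)).le]

theorem eTilde_omega_div (hαβ : α ≠ β) (hlam : lam ≠ 0) :
    eTilde μ α β lam (F.omega μ κ ε) / lam = 4 * μ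
      + ε * ((4 * α * (β - α) - 6 * (1 + α * β)) * F.slope μ κ ε / (1 + α ^ 2)) := by
  have hA : (1 + α ^ 2 : ℝ) ≠ 0 := by positivity
  rw [eTilde_eq hαβ, F.eC_omega _ _ _ hαβ, coeff_re, coeff_re, omega]
  field_simp
  ring

theorem orbit_zero_eq_zeroOrder (hμ : 0 < μ) (hαβ : α ≠ β) (a₂ τ : ℝ) :
    F.orbit μ (-(4 * dC α β * a₂)) lam 0 τ = zeroOrder μ α β lam a₂ σ τ := by
  have hd := dC_ne_zero hαβ
  have hsq : √μ ^ 2 = μ := Real.sq_sqrt hμ.le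
  have he : eTilde μ α β lam (μ * α) = 4 * lam * μ := by
    rw [eTilde_eq hαβ, coeff_re, eC, sub_self, zero_div]
    field_simp
    ring
  have hp : (coeff α μ (μ * α)).re = μ := by
    rw [coeff_re]
    field_simp
  have hcos := F.mul_cos_two_mul (√μ * τ)
  have hsin := F.mul_sin_two_mul (√μ * τ)
  rw [← mul_assoc] at hcos hsin
  have hsc := Real.sin_sq_add_cos_sq (√μ * τ + F.shift)
  rw [orbit, profile_zero, profileDeriv_zero, F.omega_zero, F.slope_zero _ _ hαβ, F.detuning_zero,
    zeroOrder]
  generalize Real.cos (2 * √μ * τ) = c at hcos ⊢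
  ext i
  fin_cases i <;>
    simp only [orbitPoint, he, hp, Complex.normSq_ofReal, Complex.conj_ofReal,
      ← Complex.ofReal_mul, Complex.ofReal_re, Complex.ofReal_im, Matrix.cons_val,
      Fin.reduceFinMk, Fin.zero_eta, Fin.mk_one] <;>
    field_simp
  · linear_combination
      -8 * a₂ * lam * Real.sin (√μ * τ + F.shift) ^ 2 * hsq - 8 * a₂ * lam * μ * hsc
  · linear_combination 4 * lam ^ 2 * a₂ * √μ * (aC α β)⁻¹ * hsin
  · linear_combination -2 * a₂ * hcos
  · linear_combination 2 * a₂ * hsin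

end ProfileFamily

namespace ProfileFamily

/-- The range of parameters in which `F.orbit μ κ lam ε` is a solution: the profile exists, the
truncation in `detuning` is inactive, the linear part has nonzero eigenvalues `± i √(ẽ / lam)`, and
the plane waves of frequency `omega` have real wavenumbers `± √(μ - ε * slope)`. -/
structure Admissible {α β σ : ℝ} (F : ProfileFamily (coeff α 1 β) σ) (μ κ lam ε : ℝ) : Prop where
  abs_le_radius : |κ * ε / μ| ≤ F.radius
  detuning_eq : F.detuning μ κ ε = 1 + κ * ε / μ * (F.freqShift μ κ ε).re
  eTilde_div_pos : 0 < eTilde μ α β lam (F.omega μ κ ε) / lam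
  mul_slope_lt : ε * F.slope μ κ ε < μ

variable {α β σ : ℝ} (F : ProfileFamily (coeff α 1 β) σ) {μ κ lam ε : ℝ}

theorem eventually_admissible (hμ : 0 < μ) (hαβ : α ≠ β) (hlam : lam ≠ 0) :
    ∀ᶠ ε in nhds 0, F.Admissible μ κ lam ε := by
  have hre := F.continuous_re_freqShift μ κ
  have hslope := F.continuous_slope μ κ
  have hradius : ∀ᶠ ε in nhds 0, |κ * ε / μ| < F.radius :=
    (by fun_prop : Continuous fun ε => |κ * ε / μ|).continuousAt.eventually_lt_const <| by
      simpa only [mul_zero, zero_div, abs_zero] using F.radius_pos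
  have hdetuning : ∀ᶠ ε in nhds 0, 1 / 2 < 1 + κ * ε / μ * (F.freqShift μ κ ε).re :=
    (by fun_prop : Continuous fun ε => 1 + κ * ε / μ * (F.freqShift μ κ ε).re)
      |>.continuousAt.eventually_const_lt <| by
        simpa only [mul_zero, zero_div, zero_mul, add_zero] using one_half_lt_one
  have heTilde : ∀ᶠ ε in nhds 0, 0 < eTilde μ α β lam (F.omega μ κ ε) / lam :=
    ((F.continuous_eTilde_omega μ κ lam).div_const lam).continuousAt.eventually_const_lt <| by
      simpa only [F.eTilde_omega_div κ lam 0 hαβ hlam, zero_mul, add_zero] using by positivity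
  have hwave : ∀ᶠ ε in nhds 0, ε * F.slope μ κ ε < μ :=
    (continuous_id.mul hslope).continuousAt.eventually_lt_const <| by
      simpa only [id_eq, Pi.mul_apply, zero_mul] using hμ
  filter_upwards [hradius, hdetuning, heTilde, hwave] with ε h₁ h₂ h₃ h₄
  exact ⟨h₁.le, max_eq_left h₂.le, h₃, h₄⟩

theorem exists_admissible (hμ : 0 < μ) (hαβ : α ≠ β) (hlam : lam ≠ 0) :
    ∃ ε₀ > 0, ∀ ε ∈ Set.Ioo (-ε₀) ε₀, F.Admissible μ κ lam ε := by
  obtain ⟨ε₀, hε₀, hball⟩ := Metric.eventually_nhds_iff.1 (F.eventually_admissible hμ hαβ hlam)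
  refine ⟨ε₀, hε₀, fun ε hε => hball ?_⟩
  rwa [Real.dist_0_eq_abs, abs_lt]

theorem eC_omega_eq_eTilde_add (hαβ : α ≠ β) (hlam : lam ≠ 0) :
    eC μ α β (F.omega μ κ ε) = eTilde μ α β lam (F.omega μ κ ε) + aC α β / lam *
      (-(lam * eTilde μ α β lam (F.omega μ κ ε) / aC α β)
        + ε * F.couplingCorrection μ κ lam ε) := by
  have ha := aC_ne_zero hαβ
  rw [F.eC_omega μ κ ε hαβ, couplingCorrection]
  field_simp
  ring

namespace Admissible

variable {F}

theorem wavenumber_pos (h : F.Admissible μ κ lam ε) : 0 < F.wavenumber μ κ ε :=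
  Real.sqrt_pos.2 (sub_pos.2 h.mul_slope_lt)

theorem sq_wavenumber (h : F.Admissible μ κ lam ε) :
    F.wavenumber μ κ ε ^ 2 = μ - ε * F.slope μ κ ε :=
  Real.sq_sqrt (sub_pos.2 h.mul_slope_lt).le

theorem omega_eq (h : F.Admissible μ κ lam ε) :
    F.omega μ κ ε = μ * β + (α - β) * F.wavenumber μ κ ε ^ 2 := by
  rw [h.sq_wavenumber, omega]
  ring

theorem eC_omega_eq_sub (h : F.Admissible μ κ lam ε) (hαβ : α ≠ β) :
    eC μ α β (F.omega μ κ ε) = μ - F.wavenumber μ κ ε ^ 2 := by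
  rw [h.sq_wavenumber, F.eC_omega μ κ ε hαβ, sub_sub_cancel]

theorem sq_angularFreq (h : F.Admissible μ κ lam ε) (hμ : 0 < μ) (hαβ : α ≠ β) (hlam : lam ≠ 0) :
    F.angularFreq μ κ ε ^ 2 =
      eTilde μ α β lam (F.omega μ κ ε) / lam + ε * F.freqCorrection μ κ ε := by
  have hdet := (F.detuning_pos μ κ ε).ne'
  have hquot : μ / F.detuning μ κ ε =
      μ - ε * κ * (F.freqShift μ κ ε).re / F.detuning μ κ ε := by
    rw [eq_sub_iff_add_eq, ← add_div, div_eq_iff hdet, h.detuning_eq]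
    field_simp
  rw [F.eTilde_omega_div κ lam ε hαβ hlam, freqCorrection]
  linear_combination 4 * F.sq_half_angularFreq κ ε hμ + 4 * hquot

theorem detuning_mul_omega (h : F.Admissible μ κ lam ε) (hμ : 0 < μ) (hαβ : α ≠ β) :
    F.detuning μ κ ε * F.omega μ κ ε = μ * (α + κ * ε / μ * (F.freqShift μ κ ε).im) := by
  have hd : dC α β * (β - α) = 1 := one_div_mul_cancel (sub_ne_zero.2 hαβ.symm)
  have hslope : F.detuning μ κ ε * F.slope μ κ ε =
      dC α β * κ * ((F.freqShift μ κ ε).im - α * (F.freqShift μ κ ε).re) :=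
    mul_div_cancel₀ _ (F.detuning_pos μ κ ε).ne'
  have hμt : μ * (κ * ε / μ) = ε * κ := by field_simp
  rw [omega]
  linear_combination ε * (β - α) * hslope
    + ε * κ * ((F.freqShift μ κ ε).im - α * (F.freqShift μ κ ε).re) * hd
    + μ * α * h.detuning_eq - ((F.freqShift μ κ ε).im - α * (F.freqShift μ κ ε).re) * hμt

/-- Choosing `omega` and `angularFreq` so that `(Ω / 2)² (1 + t ν r(t))` is `(μ + i ω) / (1 + i α)`
turns the two real bifurcation conditions into a single complex one. -/
theorem sq_half_angularFreq_mul (h : F.Admissible μ κ lam ε) (hμ : 0 < μ) (hαβ : α ≠ β) :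
    (F.angularFreq μ κ ε / 2 : ℝ) ^ 2
        * (1 + (κ * ε / μ : ℝ) * coeff α 1 β * F.r (κ * ε / μ)) =
      coeff α μ (F.omega μ κ ε) := by
  set t := κ * ε / μ
  have hdet := (F.detuning_pos μ κ ε).ne'
  have hdetuning : (F.detuning μ κ ε : ℂ) = 1 + t * (F.freqShift μ κ ε).re := by
    exact_mod_cast h.detuning_eq
  have homega : (F.detuning μ κ ε * F.omega μ κ ε : ℂ) =
      μ * (α + t * (F.freqShift μ κ ε).im) := by
    exact_mod_cast h.detuning_mul_omega hμ hαβ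
  have hparts := Complex.re_add_im (F.freqShift μ κ ε)
  have hr : (1 + Complex.I * β) * F.r t = F.freqShift μ κ ε := rfl
  have hν := one_add_I_mul_mul_coeff α 1 β
  refine mul_left_cancel₀ (one_add_I_mul_ne_zero α) ?_
  rw [one_add_I_mul_mul_coeff α μ, ← Complex.ofReal_pow, F.sq_half_angularFreq κ ε hμ,
    Complex.ofReal_div]
  push_cast at hν
  field_simp [Complex.ofReal_ne_zero.2 hdet]
  linear_combination μ * t * F.r t * hν + μ * t * hr - μ * t * hparts - μ * hdetuning
    - Complex.I * homega

theorem solvesCubic_profile (h : F.Admissible μ κ lam ε) (hμ : 0 < μ) (hαβ : α ≠ β) :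
    SolvesCubic (coeff α μ (F.omega μ κ ε)) ((ε * (κ / F.detuning μ κ ε) : ℝ) * coeff α 1 β)
      (F.profile μ κ ε) (F.profileDeriv μ κ ε) := by
  have hscale : (F.angularFreq μ κ ε / 2) ^ 2 * (κ * ε / μ) = ε * (κ / F.detuning μ κ ε) := by
    rw [F.sq_half_angularFreq κ ε hμ]
    field_simp
  have hcubic := (F.solvesCubic _ h.abs_le_radius).comp_mul_left (F.angularFreq μ κ ε / 2)
  rwa [h.sq_half_angularFreq_mul hμ hαβ, ← mul_assoc, ← Complex.ofReal_pow, ← Complex.ofReal_mul,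
    hscale] at hcubic

theorem exists_polarForm_profile (h : F.Admissible μ κ lam ε) (hμ : 0 < μ) :
    ∃ S ψ, PolarForm σ (2 * Real.pi / F.angularFreq μ κ ε) (F.profile μ κ ε) S ψ := by
  obtain ⟨S, ψ, hpolar⟩ := F.exists_polarForm _ h.abs_le_radius
  have hperiod : Real.pi / (F.angularFreq μ κ ε / 2) = 2 * Real.pi / F.angularFreq μ κ ε := by
    rw [div_div_eq_mul_div, mul_comm]
  exact ⟨_, _, hperiod ▸ hpolar.comp_mul_left (half_pos (F.angularFreq_pos κ ε hμ)).ne'⟩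

theorem hasDerivAt_orbit (h : F.Admissible μ κ lam ε) (hμ : 0 < μ) (hαβ : α ≠ β)
    (hlam : IsLambda α β lam) (τ : ℝ) :
    HasDerivAt (F.orbit μ κ lam ε)
      ((linMatrix μ α β lam (F.omega μ κ ε)
          (-(lam * eTilde μ α β lam (F.omega μ κ ε) / aC α β))).mulVec (F.orbit μ κ lam ε τ)
        + ε • quadPart α β lam (F.couplingCorrection μ κ lam ε) (F.orbit μ κ lam ε τ)) τ :=
  hasDerivAt_orbitPoint hαβ hlam (F.eC_omega μ κ ε hαβ) (h.solvesCubic_profile hμ hαβ) τ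

theorem hasDerivAt_smul_orbit (h : F.Admissible μ κ lam ε) (hμ : 0 < μ) (hαβ : α ≠ β)
    (hlam : IsLambda α β lam) (τ : ℝ) :
    HasDerivAt (fun s => ε • F.orbit μ κ lam ε s)
      (field4 μ α β lam (F.omega μ κ ε)
        (-(lam * eTilde μ α β lam (F.omega μ κ ε) / aC α β)
          + ε * F.couplingCorrection μ κ lam ε) (ε • F.orbit μ κ lam ε τ)) τ := by
  rw [field4_smul]
  exact (h.hasDerivAt_orbit hμ hαβ hlam τ).const_smul ε

theorem isSymmetricOrbit_orbit (h : F.Admissible μ κ lam ε) (hμ : 0 < μ) (hαβ : α ≠ β)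
    (hσ : σ = 1 ∨ σ = -1) : IsSymmetricOrbit (F.orbit μ κ lam ε) := by
  obtain ⟨S, ψ, hpolar⟩ := h.exists_polarForm_profile hμ
  exact hpolar.isSymmetricOrbit (h.solvesCubic_profile hμ hαβ).hasDerivAt hσ

theorem periodic_orbit (h : F.Admissible μ κ lam ε) (hμ : 0 < μ) (hαβ : α ≠ β) :
    Function.Periodic (F.orbit μ κ lam ε) (2 * Real.pi / F.angularFreq μ κ ε) := by
  obtain ⟨S, ψ, hpolar⟩ := h.exists_polarForm_profile hμ
  exact hpolar.periodic_orbitPoint (h.solvesCubic_profile hμ hαβ).hasDerivAt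

theorem orbit_two_not_constant (h : F.Admissible μ κ lam ε) (hμ : 0 < μ) (hαβ : α ≠ β)
    (hκ : κ ≠ 0) : ¬ ∃ P₀, ∀ τ, F.orbit μ κ lam ε τ 2 = P₀ := by
  rintro ⟨P₀, hP₀⟩
  obtain ⟨θ₁, hθ₁⟩ := F.exists_eq_zero _ h.abs_le_radius
  obtain ⟨θ₂, hθ₂⟩ := F.exists_ne_zero _ h.abs_le_radius
  have hΩ : F.angularFreq μ κ ε / 2 ≠ 0 := (half_pos (F.angularFreq_pos κ ε hμ)).ne'
  have hP (θ : ℝ) : dC α β * P₀ =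
      κ / F.detuning μ κ ε * Complex.normSq (F.u (κ * ε / μ) θ) - F.slope μ κ ε := by
    rw [← hP₀ (θ / (F.angularFreq μ κ ε / 2)), orbit, dC_mul_orbitPoint_two hαβ, profile,
      mul_div_cancel₀ _ hΩ]
  have hprod : κ / F.detuning μ κ ε * Complex.normSq (F.u (κ * ε / μ) θ₂) = 0 := by
    have hzero := hP θ₁
    rw [hθ₁, map_zero, mul_zero] at hzero
    linarith [hP θ₂]
  rcases mul_eq_zero.1 hprod with hD | hnorm
  · exact div_ne_zero hκ (F.detuning_pos μ κ ε).ne' hD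
  · exact hθ₂ (Complex.normSq_eq_zero.1 hnorm)

end Admissible

theorem exists_norm_orbit_le (hμ : 0 < μ) (hαβ : α ≠ β) (ε₀ : ℝ)
    (hadm : ∀ ε ∈ Set.Ioo (-ε₀) ε₀, F.Admissible μ κ lam ε) :
    ∃ C, ∀ ε ∈ Set.Ioo (-ε₀) ε₀, ∀ τ, ‖F.orbit μ κ lam ε τ‖ ≤ C := by
  have hΩ := F.continuous_angularFreq μ κ
  have hΩ0 ε : F.angularFreq μ κ ε ≠ 0 := (F.angularFreq_pos κ ε hμ).ne'
  have hphase : Continuous fun p : ℝ × ℝ =>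
      F.orbit μ κ lam p.1 (2 * Real.pi / F.angularFreq μ κ p.1 * p.2) :=
    (F.continuous_orbit μ κ lam).comp <| continuous_fst.prodMk <|
      ((continuous_const.div hΩ hΩ0).comp continuous_fst).mul continuous_snd
  obtain ⟨C, hC⟩ := ((isCompact_Icc (a := -ε₀) (b := ε₀)).prod
    (isCompact_Icc (a := (0 : ℝ)) (b := 1))).exists_bound_of_continuousOn hphase.continuousOn
  refine ⟨C, fun ε hε τ => ?_⟩
  have hT : 0 < 2 * Real.pi / F.angularFreq μ κ ε :=
    div_pos Real.two_pi_pos (F.angularFreq_pos κ ε hμ)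
  obtain ⟨y, hy, hτ⟩ := ((hadm ε hε).periodic_orbit hμ hαβ).exists_mem_Ico₀ hT τ
  have hbound := hC (ε, y / (2 * Real.pi / F.angularFreq μ κ ε))
    ⟨⟨hε.1.le, hε.2.le⟩, div_nonneg hy.1 hT.le, (div_le_one hT).2 hy.2.le⟩
  rwa [mul_div_cancel₀ _ hT.ne', ← hτ] at hbound

theorem exists_bound (hμ : 0 < μ) (hαβ : α ≠ β) (ε₀ : ℝ)
    (hadm : ∀ ε ∈ Set.Ioo (-ε₀) ε₀, F.Admissible μ κ lam ε) :
    ∃ C, ∀ ε ∈ Set.Ioo (-ε₀) ε₀, ∀ τ, ‖F.orbit μ κ lam ε τ‖ ≤ C ∧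
      eC μ α β (F.omega μ κ ε) + dC α β * (ε * F.orbit μ κ lam ε τ 2) ≤ C * |ε| := by
  obtain ⟨C₀, hC₀⟩ := F.exists_norm_orbit_le hμ hαβ ε₀ hadm
  obtain ⟨C₁, hC₁⟩ := (isCompact_Icc (a := -ε₀) (b := ε₀)).exists_bound_of_continuousOn
    (F.continuous_slope μ κ).continuousOn
  refine ⟨max C₀ (C₁ + |dC α β| * C₀), fun ε hε τ => ⟨le_max_of_le_left (hC₀ ε hε τ), ?_⟩⟩
  have hz : |F.orbit μ κ lam ε τ 2| ≤ C₀ := (norm_le_pi_norm _ 2).trans (hC₀ ε hε τ)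
  have hslope : |F.slope μ κ ε| ≤ C₁ := hC₁ ε ⟨hε.1.le, hε.2.le⟩
  calc eC μ α β (F.omega μ κ ε) + dC α β * (ε * F.orbit μ κ lam ε τ 2)
      = (F.slope μ κ ε + dC α β * F.orbit μ κ lam ε τ 2) * ε := by
        rw [F.eC_omega μ κ ε hαβ]
        ring
    _ ≤ |F.slope μ κ ε + dC α β * F.orbit μ κ lam ε τ 2| * |ε| := by
        rw [← abs_mul]
        exact le_abs_self _
    _ ≤ (|F.slope μ κ ε| + |dC α β| * |F.orbit μ κ lam ε τ 2|) * |ε| := by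
        rw [← abs_mul (dC α β)]
        gcongr
        exact abs_add_le _ _
    _ ≤ max C₀ (C₁ + |dC α β| * C₀) * |ε| := by
        gcongr
        exact le_max_of_le_right (by gcongr)

variable {F}

theorem Admissible.exists_stationary (h : F.Admissible μ κ lam ε) (hμ : 0 < μ) (hαβ : α ≠ β)
    (hlam : IsLambda α β lam) (hεκ : 0 ≤ ε * κ) :
    ∃ R φ : ℝ → ℝ, SolvesStationary μ α β (F.omega μ κ ε) R φ ∧
      (∀ x, R x ^ 2 =
        eC μ α β (F.omega μ κ ε) + dC α β * (ε * F.orbit μ κ lam ε x 2)) ∧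
      (∀ x, angMom R φ x = (aC α β / lam * (ε * F.orbit μ κ lam ε x 1)
        - lam * (ε * F.orbit μ κ lam ε x 3)) / (1 + α ^ 2)) ∧
      (∀ x, R (-x) = -σ * R x) ∧ (∀ x, φ (-x) = φ x) ∧
      (∀ x, R (x + 2 * Real.pi / F.angularFreq μ κ ε) = -R x) ∧
      Function.Periodic φ (2 * Real.pi / F.angularFreq μ κ ε) ∧
      SolvesCGL μ α β fun x t =>
        R x * Complex.exp (Complex.I * φ x - Complex.I * F.omega μ κ ε * t) := by
  have hδ : 0 ≤ ε * (κ / F.detuning μ κ ε) := by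
    rw [← mul_div_assoc]
    exact div_nonneg hεκ (F.detuning_pos μ κ ε).le
  have he := F.eC_omega μ κ ε hαβ
  have hB := h.solvesCubic_profile hμ hαβ
  have hV := hB.sqrt_mul hδ
  obtain ⟨S, φ, hpolar⟩ := h.exists_polarForm_profile hμ
  have hsolution := hpolar.const_mul √(ε * (κ / F.detuning μ κ ε))
  refine ⟨fun x => √(ε * (κ / F.detuning μ κ ε)) * S x, φ, hsolution.solvesStationary hV,
    fun x => ?_, fun x => ?_, hsolution.amplitude_neg, hsolution.even_phase,
    hsolution.antiperiodic_amplitude, hsolution.periodic_phase, hsolution.solvesCGL hV⟩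
  · exact hpolar.sq_sqrt_mul_amplitude_eq hαβ he hδ _ x
  · exact hpolar.angMom_sqrt_mul_eq hB.hasDerivAt hαβ hlam hδ x

end ProfileFamily

end CGL

end

open CGL in
theorem mainTheorem1 (μ α β lam a₂ σ : ℝ) (hμ : 0 < μ) (hαβ : α ≠ β)
    (hlam : IsLambda α β lam) (ha₂ : a₂ ≠ 0) (hσ : σ = 1 ∨ σ = -1) :
    ∃ ε₀ > (0 : ℝ), ∃ C : ℝ, ∃ ω k₁ k₂ γ Ω q : ℝ → ℝ, ∃ X : ℝ → ℝ → Fin 4 → ℝ,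
      -- the parameters and the orbits depend continuously on `ε`, with given values at `ε = 0`
      ContinuousOn ω (Set.Ioo (-ε₀) ε₀) ∧ ContinuousOn k₁ (Set.Ioo (-ε₀) ε₀) ∧
      ContinuousOn k₂ (Set.Ioo (-ε₀) ε₀) ∧ ContinuousOn γ (Set.Ioo (-ε₀) ε₀) ∧
      ContinuousOn Ω (Set.Ioo (-ε₀) ε₀) ∧ ContinuousOn q (Set.Ioo (-ε₀) ε₀) ∧
      ContinuousOn (fun p : ℝ × ℝ => X p.1 p.2) (Set.Ioo (-ε₀) ε₀ ×ˢ Set.univ) ∧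
      ω 0 = μ * α ∧ k₂ 0 = -(3 * lam / aC α β * dC α β * a₂) ∧
      γ 0 = cC α β / aC α β * a₂ ∧ Ω 0 = 2 * √μ ∧ q 0 = √μ ∧
      (∀ τ, X 0 τ = zeroOrder μ α β lam a₂ σ τ) ∧
      ∀ ε ∈ Set.Ioo (-ε₀) ε₀,
        -- the double eigenvalue `0` has two independent eigenvectors, the others are imaginary
        0 < eTilde μ α β lam (ω ε) / lam ∧
        k₁ ε = -(lam * eTilde μ α β lam (ω ε) / aC α β) ∧
        Module.finrank ℝ
          (LinearMap.ker (Matrix.toLin' (linMatrix μ α β lam (ω ε) (k₁ ε)))) = 2 ∧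
        eC μ α β (ω ε) =
          eTilde μ α β lam (ω ε) + aC α β / lam * (k₁ ε + ε * k₂ ε) ∧
        0 < Ω ε ∧ Ω ε ^ 2 = eTilde μ α β lam (ω ε) / lam + ε * γ ε ∧
        -- the plane wave of frequency `ω ε` has wavenumber `± q ε`
        0 < q ε ∧ ω ε = μ * β + (α - β) * q ε ^ 2 ∧ eC μ α β (ω ε) = μ - q ε ^ 2 ∧
        -- the rescaled system and the 4-D system itself
        (∀ τ, HasDerivAt (X ε)
          ((linMatrix μ α β lam (ω ε) (k₁ ε)).mulVec (X ε τ)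
            + ε • quadPart α β lam (k₂ ε) (X ε τ)) τ) ∧
        (∀ τ, HasDerivAt (fun s => ε • X ε s)
          (field4 μ α β lam (ω ε) (k₁ ε + ε * k₂ ε) (ε • X ε τ)) τ) ∧
        (∀ τ, Consistent μ α β lam (ω ε) (ε • X ε τ)) ∧
        IsSymmetricOrbit (X ε) ∧ Function.Periodic (X ε) (2 * Real.pi / Ω ε) ∧
        (∀ τ, ‖X ε τ‖ ≤ C) ∧ (¬ ∃ P₀, ∀ τ, X ε τ 2 = P₀) ∧
        -- the stationary solutions of the Ginzburg-Landau equation, in the range of `ε` where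
        -- `e + d P` is non-negative
        (ε * dC α β * a₂ < 0 → ∃ R φ : ℝ → ℝ,
          SolvesStationary μ α β (ω ε) R φ ∧
          (∀ x, R x ^ 2 = eC μ α β (ω ε) + dC α β * (ε * X ε x 2)) ∧
          (∀ x, angMom R φ x =
            (aC α β / lam * (ε * X ε x 1) - lam * (ε * X ε x 3)) / (1 + α ^ 2)) ∧
          (∀ x, R (-x) = -σ * R x) ∧ (∀ x, φ (-x) = φ x) ∧
          (∀ x, R (x + 2 * Real.pi / Ω ε) = -R x) ∧
          Function.Periodic φ (2 * Real.pi / Ω ε) ∧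
          (∀ x, R x ^ 2 ≤ C * |ε|) ∧
          SolvesCGL μ α β (fun x t =>
            (R x : ℂ) * Complex.exp (Complex.I * (φ x : ℂ) - Complex.I * (ω ε : ℂ) * (t : ℂ)))) := by
  have hl := hlam.ne_zero hαβ
  obtain ⟨F⟩ := nonempty_profileFamily (coeff α 1 β) hσ
  obtain ⟨κ, hκ⟩ : ∃ κ, κ = -(4 * dC α β * a₂) := ⟨_, rfl⟩
  have hκ0 : κ ≠ 0 := by simp [hκ, dC_ne_zero hαβ, ha₂]
  obtain ⟨ε₀, hε₀, hadm⟩ := F.exists_admissible (κ := κ) hμ hαβ hl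
  obtain ⟨C, hC⟩ := F.exists_bound hμ hαβ ε₀ hadm
  refine ⟨ε₀, hε₀, C, F.omega μ κ, fun ε => -(lam * eTilde μ α β lam (F.omega μ κ ε) / aC α β),
    F.couplingCorrection μ κ lam, F.freqCorrection μ κ, F.angularFreq μ κ, F.wavenumber μ κ,
    F.orbit μ κ lam, (F.continuous_omega μ κ).continuousOn,
    ((continuous_const.mul (F.continuous_eTilde_omega μ κ lam)).div_const _).neg.continuousOn,
    (F.continuous_couplingCorrection μ κ lam).continuousOn,
    (F.continuous_freqCorrection μ κ).continuousOn, (F.continuous_angularFreq μ κ).continuousOn,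
    (F.continuous_wavenumber μ κ).continuousOn, (F.continuous_orbit μ κ lam).continuousOn,
    F.omega_zero μ κ, hκ ▸ F.couplingCorrection_zero μ lam hαβ a₂,
    hκ ▸ F.freqCorrection_zero μ hαβ a₂, F.angularFreq_zero μ κ, F.wavenumber_zero μ κ,
    hκ ▸ F.orbit_zero_eq_zeroOrder lam hμ hαβ a₂, fun ε hε => ?_⟩
  have h := hadm ε hε
  refine ⟨h.eTilde_div_pos, rfl, finrank_ker_linMatrix hl, F.eC_omega_eq_eTilde_add hαβ hl,
    F.angularFreq_pos κ ε hμ, h.sq_angularFreq hμ hαβ hl, h.wavenumber_pos, h.omega_eq,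
    h.eC_omega_eq_sub hαβ, h.hasDerivAt_orbit hμ hαβ hlam, h.hasDerivAt_smul_orbit hμ hαβ hlam,
    fun τ => consistent_smul_orbitPoint hαβ hlam (F.eC_omega μ κ ε hαβ) _ _,
    h.isSymmetricOrbit_orbit hμ hαβ hσ, h.periodic_orbit hμ hαβ, fun τ => (hC ε hε τ).1,
    h.orbit_two_not_constant hμ hαβ hκ0, fun hneg => ?_⟩
  obtain ⟨R, φ, hstat, hR, hG, hodd, heven, hanti, hper, hCGL⟩ :=
    h.exists_stationary hμ hαβ hlam (by rw [hκ]; linarith)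
  exact ⟨R, φ, hstat, hR, hG, hodd, heven, hanti, hper, fun x => (hR x).trans_le (hC ε hε x).2,
    hCGL⟩
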